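/- Fix constants $c,d\in\mathbb{N}$. There is a constant $K>0$, depending only on $c$ and $d$, such that the following holds for all integers $n\ge 1$ (universe size) and $W\ge 1$ (window size), every accuracy parameter $\nu\in(0,\tfrac14)$ and every threshold $\eta\in(0,1)$. There is a randomized one-pass streaming algorithm that uses at most $K\cdot\frac{\log^3 n}{\nu^3\eta^2}$ bits of space and has the following property. Let $u_1,\dots,u_m\in[n]$ be any fixed insertion-only stream of length $1\le m\le n^c$ (the algorithm does not know $m$ in advance), and let $f\in\mathbb{R}^n$ be the frequency vector of its active window, $$f_j=\bigl|\{\,t\in[m] : u_t=j,\ t\ge m-W+1\,\}\bigr|,\qquad j\in[n].$$ With probability at least $1-n^{-d}$ over the random choices of the algorithm, after its single pass over the stream it outputs a set $H\subseteq[n]$ together with an estimate $\widehat{f_i}$ for each $i\in H$ such that 1. every $i\in[n]$ with $f_i\ge\eta\,\|f\|_2$ belongs to $H$; 2. no $i\in[n]$ with $f_i\le\frac{\eta}{8}\,\|f\|_2$ belongs to $H$; 3. for every $i\in H$, the estimate is a $(1+\nu)$-approximation of the frequency: $\frac{1}{1+\nu}f_i\le\widehat{f_i}\le(1+\nu)f_i$.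 Here a randomized one-pass streaming algorithm for given parameters $n,W,\nu,\eta$ is a randomized state machine whose state is a memory of a fixed number $b$ of bits. It draws a fixed number $r$ of fresh fair coins before the first item and again at each item, updates its memory as a function of the memory content, the current item and the coins just drawn, and computes its output from the memory content alone. Its space is $b+r$ bits. -/

import Mathlib

noncomputable section

/-- A randomized one-pass streaming algorithm reading a stream of items from a universe of size `n`
(the item `j` of `[n] = {1, …, n}` is represented by `j - 1 : Fin n`) and producing a value in `Out`.

The only thing the algorithm remembers of the stream, and of its own earlier random choices, is the
content of a memory of `bits` bits. Before the first item and at each item it draws `coins` fresh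
fair coins; a coin that is needed again later has to be stored in the memory. The algorithm does
not know the length of the stream: the value it reports depends on the current memory content
only. -/
structure StreamingAlgorithm (n : ℕ) (Out : Type) where
  bits : ℕ
  coins : ℕ
  init : (Fin coins → Bool) → (Fin bits → Bool)
  update : (Fin bits → Bool) → Fin n → (Fin coins → Bool) → (Fin bits → Bool)
  report : (Fin bits → Bool) → Out

namespace StreamingAlgorithm

variable {n : ℕ} {Out : Type}

/-- The space in bits: the memory kept between items, plus the room for the random bits that are
drawn while one item is processed. -/
def space (A : StreamingAlgorithm n Out) : ℕ := A.bits + A.coins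

/-- The distribution of one draw of `A.coins` independent fair coins. -/
def coinLaw (A : StreamingAlgorithm n Out) : PMF (Fin A.coins → Bool) :=
  PMF.uniformOfFintype (Fin A.coins → Bool)

/-- The distribution of the memory content after a single pass over the stream `u`, whose items
arrive in list order. -/
def memoryLaw (A : StreamingAlgorithm n Out) (u : List (Fin n)) : PMF (Fin A.bits → Bool) :=
  u.foldl (fun law x => law.bind fun M => A.coinLaw.map fun r => A.update M x r)
    (A.coinLaw.map A.init)

/-- The distribution of the value reported after a single pass over the stream `u`. -/
def outputLaw (A : StreamingAlgorithm n Out) (u : List (Fin n)) : PMF Out :=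
  (A.memoryLaw u).map A.report

/-- The probability that the value reported after a single pass over `u` satisfies `P`. -/
def prob (A : StreamingAlgorithm n Out) (u : List (Fin n)) (P : Out → Prop) : ENNReal :=
  (A.outputLaw u).toOuterMeasure {o | P o}

end StreamingAlgorithm

/-- The active window: the last `W` items of the stream, or the whole stream if it has fewer than
`W` items. -/
def activeWindow {n : ℕ} (W : ℕ) (u : List (Fin n)) : List (Fin n) :=
  u.drop (u.length - W)

/-- The frequency vector induced by the active window, in `ℝⁿ` with the Euclidean norm. -/
def windowFreq {n : ℕ} (W : ℕ) (u : List (Fin n)) : EuclideanSpace ℝ (Fin n) :=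
  WithLp.toLp 2 fun i => ((activeWindow W u).count i : ℝ)

/-- A set of reported items together with an estimated frequency of each of them
(the values of `estimate` outside `items` are not part of the report). -/
structure HeavyHitterReport (n : ℕ) where
  items : Finset (Fin n)
  estimate : Fin n → ℚ

/-- The report contains every `η`-heavy hitter of `f`, contains no item `i` with
`f i ≤ (η / 8) * ‖f‖`, and estimates the frequency of each reported item up to a factor `1 + ν`. -/
def HeavyHitterReport.IsCorrect {n : ℕ} (R : HeavyHitterReport n) (ν η : ℝ)
    (f : EuclideanSpace ℝ (Fin n)) : Prop :=
  (∀ i, η * ‖f‖ ≤ f i → i ∈ R.items) ∧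
  (∀ i, f i ≤ η / 8 * ‖f‖ → i ∉ R.items) ∧
  (∀ i ∈ R.items, f i ≤ (1 + ν) * (R.estimate i : ℝ) ∧ (R.estimate i : ℝ) ≤ (1 + ν) * f i)

end

/-! All randomness is a table of seeds drawn once and stored: `D` rows of `w` seeds, each selecting
a four-wise uncorrelated sign function on `[n]`. Averaging in a row estimates frequencies and the
second moment F₂ of a list with constant probability (Chebyshev), and a majority over the rows
amplifies this exponentially in `D`. Since block boundaries depend on the seeds, a good seed is
required to be accurate on every contiguous part of the stream at once; there are only polynomially
many parts, so a union bound suffices (`IsSignFamily.card_not_goodSeed`). For a good seed everything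
else is deterministic.

At scale `k`, with `L = 4^k` and `τ = δ 2^k`, the stream is cut into consecutive blocks of F₂ about
`L`, of which only the last two are kept. The linear sketch cannot forget expired items, so a
timestamped event is logged whenever the estimated frequency of the arriving item in the current
block passes a new multiple of `τ`. Counting events from time `t` on recovers, up to `4τ`, the
frequency in any suffix that starts inside the two blocks
(`BlockState.Valid.abs_recentEvents_sub_le`). A log is short because its length is charged to F₂ of
the block: it is O(1/δ²) (`LogAccurate.length_le`).

For a query, take the finest scale whose two blocks contain the window start. The two blocks bound
F₂ of the window above by a multiple of `L`; failure of the next finer scale bounds it below. So `τ`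
is about `δ` times the norm of the window, and `δ` of order `νη` makes the error small relative to
every reported frequency (`SketchState.heavyHitters_isCorrect`).

There are O(log n) scales, O(log n) rows, `w = O(1/(νη)²)` counters per row and O(log n) bits per
counter, so the space is O(log³ n / (ν²η²)), which is within the required bound. -/

/-! ### Seeded deterministic machines as streaming algorithms -/

namespace StreamingAlgorithm

/-- The law of the memory of an algorithm that draws coins only before the first item. -/
theorem memoryLaw_of_update_eq {n : ℕ} {Out : Type} (A : StreamingAlgorithm n Out)
    (upd : (Fin A.bits → Bool) → Fin n → (Fin A.bits → Bool))
    (h : ∀ M x r, A.update M x r = upd M x) (u : List (Fin n)) :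
    A.memoryLaw u = A.coinLaw.map fun r => u.foldl upd (A.init r) := by
  induction u using List.reverseRecOn with
  | nil => rfl
  | append_singleton v x ih =>
    have hstep : A.memoryLaw (v ++ [x]) =
        (A.memoryLaw v).bind fun M => A.coinLaw.map fun r => A.update M x r := by
      simp [memoryLaw, List.foldl_append]
    rw [hstep, ih]
    have : (fun M => A.coinLaw.map fun r => A.update M x r) = fun M => PMF.pure (upd M x) := by
      funext M
      simp only [h]
      exact PMF.map_const _ _
    rw [this, ← Function.comp_def PMF.pure, PMF.bind_pure_comp, PMF.map_comp]
    congr 1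
    funext r
    simp [List.foldl_append]

/-- A deterministic state machine that is started from a random seed and whose states stay, for the
seeds of interest, in a set with at most `2 ^ b` elements can be run in `b` bits of memory. -/
theorem exists_of_fold {n : ℕ} {Out S Ω T : Type} [Fintype Ω] [Fintype T] {r b : ℕ}
    (hΩ : Fintype.card Ω = 2 ^ r) (hT : Fintype.card T ≤ 2 ^ b)
    (init : Ω → S) (step : S → Fin n → S) (out : S → Out) (F : Set S) (code : S → T)
    (hcode : Set.InjOn code F) [Nonempty S] :
    ∃ A : StreamingAlgorithm n Out, A.space = b + r ∧
      ∀ (u : List (Fin n)) (P : Out → Prop) (G : Finset Ω),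
        (∀ ω ∈ G, (∀ v, v <+: u → v.foldl step (init ω) ∈ F) ∧
          P (out (u.foldl step (init ω)))) →
        ((G.card : ENNReal) / 2 ^ r) ≤ A.prob u P := by
  classical
  obtain ⟨emb⟩ : Nonempty (T ↪ (Fin b → Bool)) :=
    Function.Embedding.nonempty_of_card_le (by simpa using hT)
  have e : (Fin r → Bool) ≃ Ω := Fintype.equivOfCardEq (by simp [hΩ])
  let enc : S → (Fin b → Bool) := fun s => emb (code s)
  have henc : Set.InjOn enc F := fun s hs s' hs' h => hcode hs hs' (emb.injective h)
  -- Off the codes of `F` the decoder returns junk; a run from a seed in `G` never leaves `F`, so it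
  -- never meets such a memory content.
  let dec : (Fin b → Bool) → S := Function.invFunOn enc F
  have hdec : ∀ s ∈ F, dec (enc s) = s := fun s hs => henc.leftInvOn_invFunOn hs
  let upd : (Fin b → Bool) → Fin n → (Fin b → Bool) := fun M x => enc (step (dec M) x)
  let A : StreamingAlgorithm n Out :=
    { bits := b
      coins := r
      init := fun ρ => enc (init (e ρ))
      update := fun M x _ => upd M x
      report := fun M => out (dec M) }
  refine ⟨A, rfl, fun u P G hG => ?_⟩
  have hrun : ∀ ω ∈ G, ∀ v, v <+: u →
      v.foldl upd (enc (init ω)) = enc (v.foldl step (init ω)) := by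
    intro ω hω v
    induction v using List.reverseRecOn with
    | nil => intro _; rfl
    | append_singleton v x ih =>
      intro hv
      have hv' : v <+: u := (List.prefix_append v [x]).trans hv
      rw [List.foldl_append, List.foldl_append, ih hv']
      simp only [List.foldl_cons, List.foldl_nil, upd]
      rw [hdec _ ((hG ω hω).1 v hv')]
  have hlaw : A.outputLaw u =
      (PMF.uniformOfFintype (Fin r → Bool)).map
        (fun ρ => out (dec (u.foldl upd (enc (init (e ρ)))))) := by
    unfold outputLaw
    rw [A.memoryLaw_of_update_eq upd (fun _ _ _ => rfl) u, PMF.map_comp]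
    rfl
  unfold prob
  rw [hlaw, PMF.toOuterMeasure_map_apply, PMF.toOuterMeasure_uniformOfFintype_apply]
  have hcard : Fintype.card (Fin r → Bool) = 2 ^ r := by simp
  rw [hcard]
  push_cast
  gcongr
  rw [← Fintype.card_coe]
  refine Fintype.card_le_of_injective
    (fun ω => ⟨e.symm ω.1, ?_⟩) ?_
  · simp only [Set.mem_preimage, Set.mem_ofPred_eq, Equiv.apply_symm_apply]
    rw [hrun ω.1 ω.2 u (List.prefix_refl u), hdec _ ((hG ω.1 ω.2).1 u (List.prefix_refl u))]
    exact (hG ω.1 ω.2).2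
  · intro a b h
    exact Subtype.ext (e.symm.injective (congrArg Subtype.val h))

end StreamingAlgorithm

/-! ### Four-wise uncorrelated signs and their moments -/

/-- Vectors over `ZMod 2` such that a sum of four of them vanishes only if they cancel in pairs. -/
theorem exists_sidon_vectors {n l : ℕ} (hl : l ≠ 0) (hn : n ≤ 2 ^ l) :
    ∃ v : Fin n → (Fin (2 * l) → ZMod 2), ∀ i j k m, v i + v j + v k + v m = 0 →
      (i = j ∧ k = m) ∨ (i = k ∧ j = m) ∨ (i = m ∧ j = k) := by
  have : Fintype (GaloisField 2 l) := Fintype.ofFinite _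
  have hcard : Fintype.card (GaloisField 2 l) = 2 ^ l := by
    rw [← Nat.card_eq_fintype_card, GaloisField.card 2 l hl]
  obtain ⟨x⟩ : Nonempty (Fin n ↪ GaloisField 2 l) :=
    Function.Embedding.nonempty_of_card_le (by simpa [hcard] using hn)
  have hfin : Module.finrank (ZMod 2) (GaloisField 2 l × GaloisField 2 l) = 2 * l := by
    rw [Module.finrank_prod, GaloisField.finrank 2 hl]; ring
  let e : (GaloisField 2 l × GaloisField 2 l) ≃ₗ[ZMod 2] (Fin (2 * l) → ZMod 2) :=
    LinearEquiv.ofFinrankEq _ _ (by simp [hfin])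
  -- The columns `(x, x³)` of the parity check matrix of a double-error-correcting BCH code.
  refine ⟨fun i => e (x i, x i ^ 3), fun i j k m h => ?_⟩
  have h0 : ((x i, x i ^ 3) + (x j, x j ^ 3) + (x k, x k ^ 3) + (x m, x m ^ 3) :
      GaloisField 2 l × GaloisField 2 l) = 0 := by
    apply e.injective
    rw [map_add, map_add, map_add, map_zero]
    exact h
  obtain ⟨h1, h3⟩ := Prod.ext_iff.1 h0
  simp only [Prod.fst_add, Prod.snd_add, Prod.fst_zero, Prod.snd_zero] at h1 h3
  have two : (2 : GaloisField 2 l) = 0 := CharTwo.two_eq_zero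
  have hsub : x m = x i + x j + x k := by linear_combination h1 - (x i + x j + x k) * two
  rw [hsub] at h3
  -- In characteristic 2, `a³ + b³ + c³ + (a + b + c)³ = (a + b)(b + c)(c + a)`.
  have hprod : (x i + x j) * ((x j + x k) * (x k + x i)) = 0 := by
    linear_combination h3 - (x i ^ 3 + x j ^ 3 + x k ^ 3 + (x i + x j) * (x j + x k) * (x k + x i)) * two
  have hz : ∀ a b : Fin n, x a + x b = 0 → a = b := fun a b hab =>
    x.injective (by linear_combination hab - x b * two)
  rcases mul_eq_zero.1 hprod with h | h
  · refine Or.inl ⟨hz _ _ h, x.injective ?_⟩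
    rw [hsub, h, zero_add]
  rcases mul_eq_zero.1 h with h | h
  · refine Or.inr (Or.inr ⟨x.injective ?_, hz _ _ h⟩)
    rw [hsub, add_assoc, h, add_zero]
  · refine Or.inr (Or.inl ⟨(hz _ _ h).symm, x.injective ?_⟩)
    linear_combination (-1 : GaloisField 2 l) * hsub - h

/-- The sign `(-1) ^ ⟨r, v⟩`. -/
def bitSign {m : ℕ} (r : Fin m → Bool) (v : Fin m → ZMod 2) : ℤ :=
  ∏ k, if r k = true ∧ v k = 1 then -1 else 1

theorem bitSign_add {m : ℕ} (r : Fin m → Bool) (v w : Fin m → ZMod 2) :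
    bitSign r (v + w) = bitSign r v * bitSign r w := by
  unfold bitSign
  rw [← Finset.prod_mul_distrib]
  refine Finset.prod_congr rfl fun k _ => ?_
  have key : ∀ (a : Bool) (b c : ZMod 2), (if a = true ∧ b + c = 1 then (-1 : ℤ) else 1) =
      (if a = true ∧ b = 1 then -1 else 1) * if a = true ∧ c = 1 then -1 else 1 := by decide
  exact key _ _ _

theorem bitSign_mul_self {m : ℕ} (r : Fin m → Bool) (v : Fin m → ZMod 2) :
    bitSign r v * bitSign r v = 1 := by
  have h : v + v = 0 := funext fun k => CharTwo.add_self_eq_zero (v k)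
  rw [← bitSign_add, h]
  simp [bitSign]

/-- The sum factors over the coordinates, and a coordinate where `v` is nonzero contributes `1 +
(-1) = 0`. -/
theorem sum_bitSign_eq_zero {m : ℕ} {v : Fin m → ZMod 2} (hv : v ≠ 0) :
    ∑ r : Fin m → Bool, bitSign r v = 0 := by
  obtain ⟨k, hk⟩ := Function.ne_iff.1 hv
  have hk1 : v k = 1 := by
    revert hk
    simp only [Pi.zero_apply]
    generalize v k = b
    revert b
    decide
  unfold bitSign
  rw [← Fintype.prod_sum (fun k (b : Bool) => if b = true ∧ v k = 1 then (-1 : ℤ) else 1)]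
  exact Finset.prod_eq_zero (Finset.mem_univ k) (by simp [hk1])

/-- A family of sign functions on `Fin n`, indexed by the finite set `Ω`, that is four-wise
uncorrelated. -/
structure IsSignFamily {n : ℕ} {Ω : Type} [Fintype Ω] (σ : Ω → Fin n → ℤ) : Prop where
  mul_self : ∀ ω i, σ ω i * σ ω i = 1
  sum_four : ∀ i j k m, ¬((i = j ∧ k = m) ∨ (i = k ∧ j = m) ∨ (i = m ∧ j = k)) →
    ∑ ω, σ ω i * σ ω j * σ ω k * σ ω m = 0

theorem exists_isSignFamily {n l : ℕ} (hl : l ≠ 0) (hn : n ≤ 2 ^ l) :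
    ∃ σ : (Fin (2 * l) → Bool) → Fin n → ℤ, IsSignFamily σ := by
  obtain ⟨v, hv⟩ := exists_sidon_vectors hl hn
  refine ⟨fun r i => bitSign r (v i), fun r i => bitSign_mul_self r _, fun i j k m h => ?_⟩
  simp only [← bitSign_add]
  exact sum_bitSign_eq_zero fun h0 => h (hv i j k m h0)

namespace IsSignFamily

variable {n : ℕ} {Ω : Type} [Fintype Ω] {σ : Ω → Fin n → ℤ}

theorem mul_self_real (hσ : IsSignFamily σ) (ω : Ω) (i : Fin n) :
    (σ ω i : ℝ) * σ ω i = 1 := by exact_mod_cast hσ.mul_self ω i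

theorem abs_eq_one (hσ : IsSignFamily σ) (ω : Ω) (i : Fin n) : |σ ω i| = 1 := by
  rcases mul_self_eq_one_iff.1 (hσ.mul_self ω i) with h | h <;> simp [h]

theorem sum_two (hσ : IsSignFamily σ) (i j : Fin n) :
    ∑ ω, (σ ω i : ℝ) * σ ω j = if i = j then (Fintype.card Ω : ℝ) else 0 := by
  split_ifs with h
  · subst h
    simp [hσ.mul_self_real]
  -- Repeating `i` uses up two signs, since `σ i * σ i = 1`, and leaves the product of two.
  · have := hσ.sum_four i j i i (by tauto)
    have h2 : ∑ ω, σ ω i * σ ω j = 0 := by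
      rw [← this]
      refine Finset.sum_congr rfl fun ω _ => ?_
      rw [mul_assoc (σ ω i * σ ω j), hσ.mul_self, mul_one]
    exact_mod_cast h2

/-- Only an inequality, because coinciding indices can satisfy several pairings at once. This is
enough for the fourth moment of a nonnegative vector. -/
theorem sum_four_le (hσ : IsSignFamily σ) (i j k m : Fin n) :
    ∑ ω, (σ ω i : ℝ) * σ ω j * σ ω k * σ ω m ≤ (Fintype.card Ω : ℝ) *
      ((if i = j then 1 else 0) * (if k = m then 1 else 0) +
        (if i = k then 1 else 0) * (if j = m then 1 else 0) +
        (if i = m then 1 else 0) * (if j = k then 1 else 0)) := by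
  by_cases h : (i = j ∧ k = m) ∨ (i = k ∧ j = m) ∨ (i = m ∧ j = k)
  · have h1 : ∑ ω, (σ ω i : ℝ) * σ ω j * σ ω k * σ ω m ≤ Fintype.card Ω := by
      calc _ ≤ ∑ _ω : Ω, (1 : ℝ) := by
            refine Finset.sum_le_sum fun ω _ => le_of_abs_le ?_
            have ha : ∀ a, |(σ ω a : ℝ)| = 1 := fun a => by exact_mod_cast hσ.abs_eq_one ω a
            simp [abs_mul, ha]
        _ = _ := by simp
    refine h1.trans (le_mul_of_one_le_right (by positivity) ?_)
    rcases h with ⟨h, h'⟩ | ⟨h, h'⟩ | ⟨h, h'⟩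
    · simp only [h, h', if_true]
      have : (0:ℝ) ≤ (if j = m then 1 else 0) * (if j = m then 1 else 0) +
        (if j = m then 1 else 0) * (if j = m then 1 else 0) := by positivity
      linarith
    · simp only [h, h', if_true]
      have h1 : (0:ℝ) ≤ (if k = m then 1 else 0) * (if k = m then 1 else 0) := by positivity
      have h2 : (0:ℝ) ≤ (if k = m then 1 else 0) * (if m = k then 1 else 0) := by positivity
      linarith
    · simp only [h, h', if_true]
      have h1 : (0:ℝ) ≤ (if m = k then 1 else 0) * (if k = m then 1 else 0) := by positivity
      linarith
  · have h0 : ∑ ω, (σ ω i : ℝ) * σ ω j * σ ω k * σ ω m = 0 := by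
      exact_mod_cast hσ.sum_four i j k m h
    rw [h0]
    positivity

/-- Second moment of a random signed sum. -/
theorem sum_sq (hσ : IsSignFamily σ) (f : Fin n → ℝ) :
    ∑ ω, (∑ k, (σ ω k : ℝ) * f k) ^ 2 = Fintype.card Ω * ∑ k, f k ^ 2 := by
  calc ∑ ω, (∑ k, (σ ω k : ℝ) * f k) ^ 2
      = ∑ ω, ∑ k, ∑ m, f k * f m * ((σ ω k : ℝ) * σ ω m) := by
        refine Finset.sum_congr rfl fun ω _ => ?_
        rw [sq, Finset.sum_mul_sum]
        exact Finset.sum_congr rfl fun k _ => Finset.sum_congr rfl fun m _ => by ring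
    _ = ∑ k, ∑ m, f k * f m * ∑ ω, (σ ω k : ℝ) * σ ω m := by
        simp only [Finset.mul_sum]
        rw [Finset.sum_comm]
        exact Finset.sum_congr rfl fun k _ => Finset.sum_comm
    _ = _ := by
        simp only [hσ.sum_two, mul_ite, mul_zero, Finset.sum_ite_eq, Finset.mem_univ, if_true]
        rw [Finset.mul_sum]
        exact Finset.sum_congr rfl fun k _ => by ring

/-- A signed coordinate of the sketch is an unbiased estimate. -/
theorem sum_sign_mul (hσ : IsSignFamily σ) (f : Fin n → ℝ) (i : Fin n) :
    ∑ ω, (σ ω i : ℝ) * ∑ k, (σ ω k : ℝ) * f k = Fintype.card Ω * f i := by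
  calc _ = ∑ k, f k * ∑ ω, (σ ω i : ℝ) * σ ω k := by
        simp only [Finset.mul_sum]
        rw [Finset.sum_comm]
        exact Finset.sum_congr rfl fun k _ => Finset.sum_congr rfl fun ω _ => by ring
    _ = _ := by
        simp only [hσ.sum_two, mul_ite, mul_zero, Finset.sum_ite_eq, Finset.mem_univ, if_true]
        ring

/-- Fourth moment of a random signed sum. -/
theorem sum_pow_four_le (hσ : IsSignFamily σ) (f : Fin n → ℝ) (hf : ∀ i, 0 ≤ f i) :
    ∑ ω, (∑ k, (σ ω k : ℝ) * f k) ^ 4 ≤ 3 * Fintype.card Ω * (∑ k, f k ^ 2) ^ 2 := by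
  calc ∑ ω, (∑ k, (σ ω k : ℝ) * f k) ^ 4
      = ∑ ω, ∑ i, ∑ j, ∑ k, ∑ m,
          f i * f j * f k * f m * ((σ ω i : ℝ) * σ ω j * σ ω k * σ ω m) := by
        refine Finset.sum_congr rfl fun ω _ => ?_
        have : (∑ k, (σ ω k : ℝ) * f k) ^ 4 = (∑ k, (σ ω k : ℝ) * f k) *
          ((∑ k, (σ ω k : ℝ) * f k) * ((∑ k, (σ ω k : ℝ) * f k) * (∑ k, (σ ω k : ℝ) * f k))) := by
          ring
        rw [this]
        simp only [Finset.sum_mul, Finset.mul_sum]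
        exact Finset.sum_congr rfl fun i _ => Finset.sum_congr rfl fun j _ =>
          Finset.sum_congr rfl fun k _ => Finset.sum_congr rfl fun m _ => by ring
    _ = ∑ i, ∑ j, ∑ k, ∑ m, f i * f j * f k * f m *
          ∑ ω, ((σ ω i : ℝ) * σ ω j * σ ω k * σ ω m) := by
        simp only [Finset.mul_sum]
        rw [Finset.sum_comm]
        refine Finset.sum_congr rfl fun i _ => ?_
        rw [Finset.sum_comm]
        refine Finset.sum_congr rfl fun j _ => ?_
        rw [Finset.sum_comm]
        exact Finset.sum_congr rfl fun k _ => Finset.sum_comm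
    _ ≤ ∑ i, ∑ j, ∑ k, ∑ m, f i * f j * f k * f m * ((Fintype.card Ω : ℝ) *
      ((if i = j then 1 else 0) * (if k = m then 1 else 0) +
        (if i = k then 1 else 0) * (if j = m then 1 else 0) +
        (if i = m then 1 else 0) * (if j = k then 1 else 0))) := by
        refine Finset.sum_le_sum fun i _ => Finset.sum_le_sum fun j _ =>
          Finset.sum_le_sum fun k _ => Finset.sum_le_sum fun m _ =>
          mul_le_mul_of_nonneg_left (hσ.sum_four_le i j k m) ?_
        exact mul_nonneg (mul_nonneg (mul_nonneg (hf i) (hf j)) (hf k)) (hf m)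
    _ = _ := by
        have key : ∀ i j : Fin n, ∑ k, ∑ m, f i * f j * f k * f m * ((Fintype.card Ω : ℝ) *
            ((if i = j then 1 else 0) * (if k = m then 1 else 0) +
            (if i = k then 1 else 0) * (if j = m then 1 else 0) +
            (if i = m then 1 else 0) * (if j = k then 1 else 0))) =
            (if i = j then f i * f j * Fintype.card Ω * ∑ k, f k ^ 2 else 0) +
              2 * Fintype.card Ω * (f i ^ 2 * f j ^ 2) := by
          intro i j
          simp only [mul_add, Finset.sum_add_distrib, mul_ite, mul_one, mul_zero,
            Finset.sum_ite_eq, Finset.mem_univ, if_true]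
          have h1 : ∑ k, (if i = j then f i * f j * f k * f k * (Fintype.card Ω : ℝ) else 0) =
              if i = j then f i * f j * Fintype.card Ω * ∑ k, f k ^ 2 else 0 := by
            split_ifs
            · rw [Finset.mul_sum]
              exact Finset.sum_congr rfl fun k _ => by ring
            · simp
          have h2 : ∀ m, ∑ k, (if j = k then if i = m then
              f i * f j * f k * f m * (Fintype.card Ω : ℝ) else 0 else 0) =
              if i = m then f i * f j * f j * f m * (Fintype.card Ω : ℝ) else 0 := by
            intro m; simp
          rw [Finset.sum_comm (f := fun k m => if j = k then if i = m then
              f i * f j * f k * f m * (Fintype.card Ω : ℝ) else 0 else 0)]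
          simp only [h1, h2, Finset.sum_ite_eq, Finset.mem_univ, if_true]
          ring
        simp only [key, Finset.sum_add_distrib, Finset.sum_ite_eq, Finset.mem_univ, if_true]
        have h4 : ∑ i, f i * f i * (Fintype.card Ω : ℝ) * ∑ k, f k ^ 2 =
            Fintype.card Ω * (∑ k, f k ^ 2) ^ 2 := by
          rw [← Finset.sum_mul, ← Finset.sum_mul, sq (∑ k, f k ^ 2)]
          simp only [← sq]
          ring
        have h5 : ∑ i, ∑ j, 2 * (Fintype.card Ω : ℝ) * (f i ^ 2 * f j ^ 2) =
            2 * Fintype.card Ω * (∑ k, f k ^ 2) ^ 2 := by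
          simp only [← Finset.mul_sum]
          rw [sq (∑ k, f k ^ 2), ← Finset.sum_mul]
        rw [h4, h5]
        ring

end IsSignFamily

/-! ### Averaging, Chebyshev and amplification by majority -/

/-- The second moment of a sum of `w` independent centred copies of `Y`. -/
theorem sum_sq_sum_le {Ω : Type} [Fintype Ω] (Y : Ω → ℝ) (V : ℝ) (h0 : ∑ ω, Y ω = 0)
    (hV : ∑ ω, Y ω ^ 2 ≤ V * Fintype.card Ω) (w : ℕ) :
    ∑ ρ : Fin w → Ω, (∑ j, Y (ρ j)) ^ 2 ≤ w * V * Fintype.card (Fin w → Ω) := by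
  induction w with
  | zero => simp
  | succ w ih =>
    rw [← (Fin.consEquiv fun _ => Ω).sum_comp, Fintype.sum_prod_type]
    have hcard : (Fintype.card (Fin (w + 1) → Ω) : ℝ) =
        Fintype.card Ω * Fintype.card (Fin w → Ω) := by simp [pow_succ, mul_comm]
    have hexp : ∀ (x : Ω) (ρ : Fin w → Ω),
        (∑ j, Y ((Fin.consEquiv fun _ => Ω) (x, ρ) j)) ^ 2 =
          Y x ^ 2 + 2 * (Y x * ∑ j, Y (ρ j)) + (∑ j, Y (ρ j)) ^ 2 := by
      intro x ρ
      simp only [Fin.consEquiv_apply, Fin.sum_univ_succ, Fin.cons_zero, Fin.cons_succ]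
      ring
    simp only [hexp, Finset.sum_add_distrib, ← Finset.mul_sum, ← Finset.sum_mul, h0,
      Finset.sum_const, Finset.card_univ, nsmul_eq_mul, zero_mul, mul_zero, add_zero]
    rw [hcard]
    have h1 := mul_le_mul_of_nonneg_left hV (Nat.cast_nonneg (α := ℝ) (Fintype.card (Fin w → Ω)))
    have h2 := mul_le_mul_of_nonneg_left ih (Nat.cast_nonneg (α := ℝ) (Fintype.card Ω))
    push_cast at h1 h2 ⊢
    linarith

/-- Chebyshev's inequality for the uniform distribution on a finite type. -/
theorem card_filter_lt_sq {ι : Type} [Fintype ι] (S : ι → ℝ) {V : ℝ} (hV : 0 ≤ V)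
    (h : ∑ i, S i ^ 2 ≤ V * Fintype.card ι) :
    16 * (Finset.univ.filter fun i => 16 * V < S i ^ 2).card ≤ Fintype.card ι := by
  rcases hV.eq_or_lt with rfl | hV
  · have h0 : ∀ i, S i ^ 2 = 0 := by
      have hz : ∑ i, S i ^ 2 = 0 :=
        le_antisymm (by simpa using h) (Finset.sum_nonneg fun i _ => sq_nonneg _)
      intro i
      exact (Finset.sum_eq_zero_iff_of_nonneg fun i _ => sq_nonneg (S i)).1 hz i
        (Finset.mem_univ i)
    simp [h0]
  · have h1 : ((Finset.univ.filter fun i => 16 * V < S i ^ 2).card : ℝ) * (16 * V) ≤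
        V * Fintype.card ι := by
      calc _ = ∑ i ∈ Finset.univ.filter fun i => 16 * V < S i ^ 2, 16 * V := by simp
        _ ≤ ∑ i ∈ Finset.univ.filter fun i => 16 * V < S i ^ 2, S i ^ 2 :=
          Finset.sum_le_sum fun i hi => (Finset.mem_filter.1 hi).2.le
        _ ≤ ∑ i, S i ^ 2 := Finset.sum_le_sum_of_subset_of_nonneg (Finset.filter_subset _ _)
          fun i _ _ => sq_nonneg _
        _ ≤ _ := h
    have h2 : V * (16 * ((Finset.univ.filter fun i => 16 * V < S i ^ 2).card : ℝ)) ≤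
        V * Fintype.card ι := by linarith
    exact_mod_cast le_of_mul_le_mul_left h2 hV

open Classical in
/-- More than half of the elements of `Fin D` satisfy `P`. -/
def Majority {D : ℕ} (P : Fin D → Prop) : Prop :=
  D < 2 * (Finset.univ.filter P).card

theorem Majority.exists_and {D : ℕ} {P Q : Fin D → Prop} (hP : Majority P) (hQ : Majority Q) :
    ∃ a, P a ∧ Q a := by
  classical
  unfold Majority at hP hQ
  by_contra! h
  have hdis : Disjoint (Finset.univ.filter P) (Finset.univ.filter Q) := by
    rw [Finset.disjoint_filter]
    exact fun a _ => h a
  have := Finset.card_le_univ (Finset.univ.filter P ∪ Finset.univ.filter Q)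
  rw [Finset.card_union_of_disjoint hdis, Fintype.card_fin] at this
  convert_to D < 2 * (Finset.univ.filter P).card at hP
  convert_to D < 2 * (Finset.univ.filter Q).card at hQ
  omega

theorem Majority.mono {D : ℕ} {P Q : Fin D → Prop} (hP : Majority P) (h : ∀ a, P a → Q a) :
    Majority Q := by
  classical
  unfold Majority at hP ⊢
  exact lt_of_lt_of_le hP (Nat.mul_le_mul_left 2 (Finset.card_le_card
    (Finset.monotone_filter_right _ fun a _ => h a)))

theorem Majority.exists_and_not {D : ℕ} {P Q : Fin D → Prop} (hP : Majority P)
    (hQ : ¬Majority Q) : ∃ a, P a ∧ ¬Q a := by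
  by_contra! h
  exact hQ (hP.mono h)

open Classical in
/-- Independent repetitions drive down the probability that no majority of them is good. -/
theorem card_not_majority {Ω : Type} [Fintype Ω] (P : Ω → Prop)
    (h : 16 * (Finset.univ.filter fun ω => ¬P ω).card ≤ Fintype.card Ω) (k : ℕ) :
    4 ^ k * (Finset.univ.filter fun ω : Fin (2 * k) → Ω => ¬Majority fun a => P (ω a)).card ≤
      Fintype.card (Fin (2 * k) → Ω) := by
  set N := Fintype.card Ω
  -- Exponential Markov bound: without a good majority at least `k` of the `2k` factors are 16, so
  -- the product is at least `16^k`, whereas its mean is at most `(31/16)^(2k) ≤ 4^k`.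
  set y : Ω → ℝ := fun ω => if P ω then 1 else 16
  have hy : ∑ ω, y ω ≤ 31 / 16 * N := by
    have h1 : ∑ ω, y ω = N + 15 * (Finset.univ.filter fun ω => ¬P ω).card := by
      have : ∀ ω, y ω = 1 + 15 * if ¬P ω then 1 else 0 := by
        intro ω; by_cases hω : P ω <;> simp [y, hω]; norm_num
      simp only [this, Finset.sum_add_distrib, ← Finset.mul_sum, Finset.sum_boole]
      simp [N]
    have h2 : (16 : ℝ) * (Finset.univ.filter fun ω => ¬P ω).card ≤ N := by exact_mod_cast h
    linarith
  have hy0 : 0 ≤ ∑ ω, y ω := Finset.sum_nonneg fun ω _ => by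
    simp only [y]; split_ifs <;> norm_num
  have hsum : ∑ ω : Fin (2 * k) → Ω, ∏ a, y (ω a) = (∑ ω, y ω) ^ (2 * k) := by
    rw [← Fintype.prod_sum (fun _ : Fin (2 * k) => y)]
    simp
  have hle : ∀ ω : Fin (2 * k) → Ω, ¬(Majority fun a => P (ω a)) →
      (16 : ℝ) ^ k ≤ ∏ a, y (ω a) := by
    intro ω hω
    have hc : k ≤ (Finset.univ.filter fun a => ¬P (ω a)).card := by
      have := Finset.card_filter_add_card_filter_not (s := Finset.univ) (fun a => P (ω a))
      rw [Finset.card_univ, Fintype.card_fin] at this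
      unfold Majority at hω
      omega
    have : ∏ a, y (ω a) = 16 ^ (Finset.univ.filter fun a => ¬P (ω a)).card := by
      simp only [y]
      rw [Finset.prod_ite]
      simp
    rw [this]
    exact pow_le_pow_right₀ (by norm_num) hc
  have hmarkov : ((Finset.univ.filter fun ω : Fin (2 * k) → Ω =>
      ¬Majority fun a => P (ω a)).card : ℝ) * 16 ^ k ≤ (31 / 16 * N) ^ (2 * k) := by
    calc _ = ∑ ω ∈ Finset.univ.filter fun ω : Fin (2 * k) → Ω =>
          ¬Majority fun a => P (ω a), (16 : ℝ) ^ k := by simp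
      _ ≤ ∑ ω ∈ Finset.univ.filter fun ω : Fin (2 * k) → Ω =>
          ¬Majority fun a => P (ω a), ∏ a, y (ω a) :=
        Finset.sum_le_sum fun ω hω => hle ω (Finset.mem_filter.1 hω).2
      _ ≤ ∑ ω : Fin (2 * k) → Ω, ∏ a, y (ω a) :=
        Finset.sum_le_sum_of_subset_of_nonneg (Finset.filter_subset _ _) fun ω _ _ =>
          Finset.prod_nonneg fun a _ => by simp only [y]; split_ifs <;> norm_num
      _ = (∑ ω, y ω) ^ (2 * k) := hsum
      _ ≤ _ := by gcongr
  have hpow : (31 / 16 * N : ℝ) ^ (2 * k) ≤ 4 ^ k * N ^ (2 * k) := by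
    rw [mul_pow, pow_mul]
    gcongr
    norm_num
  have hfin : (4 : ℝ) ^ k * (4 ^ k * (Finset.univ.filter fun ω : Fin (2 * k) → Ω =>
      ¬Majority fun a => P (ω a)).card) ≤ 4 ^ k * N ^ (2 * k) := by
    have : (16 : ℝ) ^ k = 4 ^ k * 4 ^ k := by rw [← mul_pow]; norm_num
    rw [this] at hmarkov
    linarith
  have := le_of_mul_le_mul_left hfin (by positivity)
  have hc : Fintype.card (Fin (2 * k) → Ω) = N ^ (2 * k) := by simp [N]
  rw [hc]
  exact_mod_cast this

/-! ### Accuracy of the sketches -/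

/-- The second frequency moment of a list of items. -/
noncomputable def secondMoment {n : ℕ} (g : List (Fin n)) : ℝ := ∑ i, (g.count i : ℝ) ^ 2

theorem secondMoment_nonneg {n : ℕ} (g : List (Fin n)) : 0 ≤ secondMoment g :=
  Finset.sum_nonneg fun _ _ => sq_nonneg _

/-- The linear sketch of a list under the random signs selected by the seeds `ρ`. -/
def rowSketch {n w : ℕ} {Ω : Type} (σ : Ω → Fin n → ℤ) (ρ : Fin w → Ω) (g : List (Fin n)) :
    Fin w → ℤ :=
  fun j => (g.map (σ (ρ j))).sum

/-- The estimate of the frequency of `i` from a row of the sketch. -/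
noncomputable def pointEstimate {n w : ℕ} {Ω : Type} (σ : Ω → Fin n → ℤ) (ρ : Fin w → Ω)
    (z : Fin w → ℤ) (i : Fin n) : ℝ :=
  (∑ j, (σ (ρ j) i : ℝ) * z j) / w

/-- The estimate of the second moment from a row of the sketch. -/
noncomputable def momentEstimate {w : ℕ} (z : Fin w → ℤ) : ℝ := (∑ j, (z j : ℝ) ^ 2) / w

theorem sum_map_eq_sum_mul_count {n : ℕ} (s : Fin n → ℤ) (g : List (Fin n)) :
    (((g.map s).sum : ℤ) : ℝ) = ∑ k, (s k : ℝ) * g.count k := by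
  induction g with
  | nil => simp
  | cons x g ih =>
    simp only [List.map_cons, List.sum_cons, Int.cast_add, ih, List.count_cons, Nat.cast_add,
      mul_add, Finset.sum_add_distrib]
    simp [add_comm]

namespace IsSignFamily

variable {n : ℕ} {Ω : Type} [Fintype Ω] {σ : Ω → Fin n → ℤ}

-- With `X` the signed sum, `σ i * X` has mean `f i` and variance at most E X² = F₂, because the
-- sign squares to 1. Averaging `w` copies divides the variance by `w`, and Chebyshev at four
-- standard deviations loses 1/16.
open Classical in
theorem card_bad_pointEstimate (hσ : IsSignFamily σ) {w : ℕ} (hw : 0 < w) (g : List (Fin n))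
    (i : Fin n) :
    16 * (Finset.univ.filter fun ρ : Fin w → Ω =>
      ¬(pointEstimate σ ρ (rowSketch σ ρ g) i - g.count i) ^ 2 ≤
        16 / w * secondMoment g).card ≤ Fintype.card (Fin w → Ω) := by
  have hw' : (0 : ℝ) < w := by exact_mod_cast hw
  set X : Ω → ℝ := fun ω => ∑ k, (σ ω k : ℝ) * g.count k
  set Y : Ω → ℝ := fun ω => (σ ω i : ℝ) * X ω - g.count i with hY
  have h1 : ∑ ω, (σ ω i : ℝ) * X ω = Fintype.card Ω * g.count i :=
    hσ.sum_sign_mul (fun k => (g.count k : ℝ)) i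
  have h2 : ∑ ω, X ω ^ 2 = Fintype.card Ω * secondMoment g :=
    hσ.sum_sq fun k => (g.count k : ℝ)
  have hY0 : ∑ ω, Y ω = 0 := by
    simp [hY, Finset.sum_sub_distrib, h1]
  have hY2 : ∑ ω, Y ω ^ 2 ≤ secondMoment g * Fintype.card Ω := by
    have hexp : ∀ ω, Y ω ^ 2 =
        X ω ^ 2 - 2 * g.count i * ((σ ω i : ℝ) * X ω) + (g.count i : ℝ) ^ 2 := by
      intro ω
      have := hσ.mul_self_real ω i
      simp only [hY]
      linear_combination X ω ^ 2 * this
    simp only [hexp, Finset.sum_add_distrib, Finset.sum_sub_distrib, ← Finset.mul_sum, h1, h2]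
    have : 0 ≤ (Fintype.card Ω : ℝ) * (g.count i : ℝ) ^ 2 := by positivity
    simp only [Finset.sum_const, Finset.card_univ, nsmul_eq_mul]
    linarith
  have hc := card_filter_lt_sq (fun ρ : Fin w → Ω => ∑ j, Y (ρ j))
    (mul_nonneg hw'.le (secondMoment_nonneg g)) (sum_sq_sum_le Y _ hY0 hY2 w)
  refine le_trans (Nat.mul_le_mul_left 16 (Finset.card_le_card ?_)) hc
  refine Finset.monotone_filter_right _ fun ρ _ h => ?_
  have hS : ∑ j, Y (ρ j) = w * (pointEstimate σ ρ (rowSketch σ ρ g) i - g.count i) := by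
    simp only [hY, X, pointEstimate, rowSketch, sum_map_eq_sum_mul_count,
      Finset.sum_sub_distrib, Finset.sum_const, Finset.card_univ, Fintype.card_fin, nsmul_eq_mul]
    field_simp
  rw [not_le] at h
  rw [hS, mul_pow]
  calc 16 * (w * secondMoment g) = (w : ℝ) ^ 2 * (16 / w * secondMoment g) := by field_simp
    _ < _ := by gcongr

-- X² has mean F₂ and variance E X⁴ - F₂² ≤ 2 F₂², hence the 32 = 16 · 2.
open Classical in
theorem card_bad_momentEstimate (hσ : IsSignFamily σ) {w : ℕ} (hw : 0 < w) (g : List (Fin n)) :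
    16 * (Finset.univ.filter fun ρ : Fin w → Ω =>
      ¬(momentEstimate (rowSketch σ ρ g) - secondMoment g) ^ 2 ≤
        32 / w * secondMoment g ^ 2).card ≤ Fintype.card (Fin w → Ω) := by
  have hw' : (0 : ℝ) < w := by exact_mod_cast hw
  set X : Ω → ℝ := fun ω => ∑ k, (σ ω k : ℝ) * g.count k
  set Y : Ω → ℝ := fun ω => X ω ^ 2 - secondMoment g with hY
  have h2 : ∑ ω, X ω ^ 2 = Fintype.card Ω * secondMoment g :=
    hσ.sum_sq fun k => (g.count k : ℝ)
  have h4 : ∑ ω, X ω ^ 4 ≤ 3 * Fintype.card Ω * secondMoment g ^ 2 :=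
    hσ.sum_pow_four_le (fun k => (g.count k : ℝ)) fun _ => Nat.cast_nonneg _
  have hY0 : ∑ ω, Y ω = 0 := by
    simp [hY, Finset.sum_sub_distrib, h2]
  have hY2 : ∑ ω, Y ω ^ 2 ≤ 2 * secondMoment g ^ 2 * Fintype.card Ω := by
    have hexp : ∀ ω, Y ω ^ 2 =
        X ω ^ 4 - 2 * secondMoment g * X ω ^ 2 + secondMoment g ^ 2 := by
      intro ω
      simp only [hY]
      ring
    simp only [hexp, Finset.sum_add_distrib, Finset.sum_sub_distrib, ← Finset.mul_sum, h2]
    simp only [Finset.sum_const, Finset.card_univ, nsmul_eq_mul]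
    linarith
  have hc := card_filter_lt_sq (fun ρ : Fin w → Ω => ∑ j, Y (ρ j))
    (V := w * (2 * secondMoment g ^ 2)) (by positivity) (sum_sq_sum_le Y _ hY0 hY2 w)
  refine le_trans (Nat.mul_le_mul_left 16 (Finset.card_le_card ?_)) hc
  refine Finset.monotone_filter_right _ fun ρ _ h => ?_
  have hS : ∑ j, Y (ρ j) = w * (momentEstimate (rowSketch σ ρ g) - secondMoment g) := by
    simp only [hY, X, momentEstimate, rowSketch, sum_map_eq_sum_mul_count,
      Finset.sum_sub_distrib, Finset.sum_const, Finset.card_univ, Fintype.card_fin, nsmul_eq_mul]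
    field_simp
  rw [not_le] at h
  rw [hS, mul_pow]
  calc 16 * (w * (2 * secondMoment g ^ 2)) = (w : ℝ) ^ 2 * (32 / w * secondMoment g ^ 2) := by
        field_simp
        ring
    _ < _ := by gcongr

end IsSignFamily

/-- The sketches of all contiguous parts of the stream `u` are accurate in most rows. -/
def GoodSeed {n w D : ℕ} {Ω : Type} (σ : Ω → Fin n → ℤ) (s : Fin D → Fin w → Ω)
    (u : List (Fin n)) : Prop :=
  ∀ g, g <:+: u →
    (∀ i, Majority fun a =>
      (pointEstimate σ (s a) (rowSketch σ (s a) g) i - g.count i) ^ 2 ≤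
        16 / w * secondMoment g) ∧
    Majority fun a =>
      (momentEstimate (rowSketch σ (s a) g) - secondMoment g) ^ 2 ≤
        32 / w * secondMoment g ^ 2

theorem List.IsInfix.exists_drop_take {α : Type} {g u : List α} (h : g <:+: u) :
    ∃ s t : Fin (u.length + 1), g = (u.take t).drop s := by
  obtain ⟨a, b, rfl⟩ := h
  refine ⟨⟨a.length, ?_⟩, ⟨a.length + g.length, ?_⟩, ?_⟩
  · simp only [List.length_append]; omega
  · simp only [List.length_append]; omega
  · simp [List.take_append]

-- Union bound over the two cut positions of a contiguous part and over an `Option (Fin n)`: `some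
-- i` is the estimate of item `i`, `none` the moment estimate.
open Classical in
theorem IsSignFamily.card_not_goodSeed {n : ℕ} {Ω : Type} [Fintype Ω] {σ : Ω → Fin n → ℤ}
    (hσ : IsSignFamily σ) {w : ℕ} (hw : 0 < w) (k : ℕ) (u : List (Fin n)) :
    4 ^ k * (Finset.univ.filter fun s : Fin (2 * k) → Fin w → Ω => ¬GoodSeed σ s u).card ≤
      (u.length + 1) ^ 2 * (n + 1) * Fintype.card (Fin (2 * k) → Fin w → Ω) := by
  let seg : Fin (u.length + 1) × Fin (u.length + 1) → List (Fin n) :=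
    fun p => (u.take p.2).drop p.1
  let bad : ((Fin (u.length + 1) × Fin (u.length + 1)) × Option (Fin n)) →
      Finset (Fin (2 * k) → Fin w → Ω) := fun p =>
    match p.2 with
    | some i => Finset.univ.filter fun s => ¬Majority fun a =>
        (pointEstimate σ (s a) (rowSketch σ (s a) (seg p.1)) i - (seg p.1).count i) ^ 2 ≤
          16 / w * secondMoment (seg p.1)
    | none => Finset.univ.filter fun s => ¬Majority fun a =>
        (momentEstimate (rowSketch σ (s a) (seg p.1)) - secondMoment (seg p.1)) ^ 2 ≤
          32 / w * secondMoment (seg p.1) ^ 2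
  have hbad : ∀ p, 4 ^ k * (bad p).card ≤ Fintype.card (Fin (2 * k) → Fin w → Ω) := by
    rintro ⟨p, _ | i⟩
    · exact card_not_majority (fun ρ : Fin w → Ω =>
        (momentEstimate (rowSketch σ ρ (seg p)) - secondMoment (seg p)) ^ 2 ≤
          32 / w * secondMoment (seg p) ^ 2) (hσ.card_bad_momentEstimate hw (seg p)) k
    · exact card_not_majority (fun ρ : Fin w → Ω =>
        (pointEstimate σ ρ (rowSketch σ ρ (seg p)) i - (seg p).count i) ^ 2 ≤
          16 / w * secondMoment (seg p)) (hσ.card_bad_pointEstimate hw (seg p) i) k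
  have hsub : (Finset.univ.filter fun s : Fin (2 * k) → Fin w → Ω => ¬GoodSeed σ s u) ⊆
      Finset.univ.biUnion bad := by
    intro s hs
    have hs' := (Finset.mem_filter.1 hs).2
    simp only [Finset.mem_biUnion, Finset.mem_univ, true_and]
    by_contra hcon
    rw [not_exists] at hcon
    refine hs' fun g hg => ?_
    obtain ⟨a, b, rfl⟩ := hg.exists_drop_take
    constructor
    · intro i
      have := hcon ((a, b), some i)
      simpa [bad, seg] using this
    · have := hcon ((a, b), none)
      simpa [bad, seg] using this
  calc _ ≤ 4 ^ k * (Finset.univ.biUnion bad).card :=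
        Nat.mul_le_mul_left _ (Finset.card_le_card hsub)
    _ ≤ 4 ^ k * ∑ p, (bad p).card := Nat.mul_le_mul_left _ Finset.card_biUnion_le
    _ = ∑ p, 4 ^ k * (bad p).card := Finset.mul_sum _ _ _
    _ ≤ ∑ _p : (Fin (u.length + 1) × Fin (u.length + 1)) × Option (Fin n),
          Fintype.card (Fin (2 * k) → Fin w → Ω) := Finset.sum_le_sum fun p _ => hbad p
    _ = _ := by
        rw [Finset.sum_const, Finset.card_univ, smul_eq_mul, Fintype.card_prod, Fintype.card_prod,
          Fintype.card_option, Fintype.card_fin, Fintype.card_fin]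
        ring

/-! ### Event logs -/

/-- The number of logged events of the item `i` before the position `t`. -/
def eventsBefore {n : ℕ} (ℓ : List (Fin n × ℕ)) (i : Fin n) (t : ℕ) : ℕ :=
  ℓ.countP fun e => e.1 = i ∧ e.2 < t

/-- The number of logged events of the item `i` from the position `t` on. -/
def eventsFrom {n : ℕ} (ℓ : List (Fin n × ℕ)) (i : Fin n) (t : ℕ) : ℕ :=
  ℓ.countP fun e => e.1 = i ∧ t ≤ e.2

/-- The number of logged events of the item `i`. -/
def eventsOf {n : ℕ} (ℓ : List (Fin n × ℕ)) (i : Fin n) : ℕ :=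
  ℓ.countP fun e => e.1 = i

theorem eventsBefore_add_eventsFrom {n : ℕ} (ℓ : List (Fin n × ℕ)) (i : Fin n) (t : ℕ) :
    eventsBefore ℓ i t + eventsFrom ℓ i t = eventsOf ℓ i := by
  induction ℓ with
  | nil => rfl
  | cons e ℓ ih =>
    simp only [eventsBefore, eventsFrom, eventsOf, List.countP_cons, Bool.decide_and] at ih ⊢
    by_cases h1 : e.1 = i <;> by_cases h2 : e.2 < t <;>
      simp [h1, h2, Nat.not_le.2, Nat.not_lt.1] <;> omega

/-- The log `ℓ` of the part of `v` from position `s` on: at all times, the number of events of an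
item is, in units of `τ`, its number of occurrences up to a bounded error. -/
structure LogAccurate {n : ℕ} (τ : ℝ) (v : List (Fin n)) (s : ℕ) (ℓ : List (Fin n × ℕ)) :
    Prop where
  le_time : ∀ e ∈ ℓ, s ≤ e.2
  time_lt : ∀ e ∈ ℓ, e.2 < v.length
  upper : ∀ i t, s ≤ t → t ≤ v.length →
    τ * eventsBefore ℓ i t ≤ ((v.take t).drop s).count i + τ / 2
  lower : ∀ i t, s ≤ t → t ≤ v.length →
    (((v.take t).drop s).count i : ℝ) ≤ τ * eventsBefore ℓ i t + 3 * τ / 2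

namespace LogAccurate

variable {n : ℕ} {τ : ℝ} {v : List (Fin n)} {s : ℕ} {ℓ : List (Fin n × ℕ)}

theorem eventsBefore_length (h : LogAccurate τ v s ℓ) (i : Fin n) :
    eventsBefore ℓ i v.length = eventsOf ℓ i := by
  refine List.countP_congr fun e he => ?_
  simp [h.time_lt e he]

theorem nil (hτ : 0 ≤ τ) : LogAccurate τ v v.length [] where
  le_time := by simp
  time_lt := by simp
  upper := fun i t h1 h2 => by
    obtain rfl : t = v.length := le_antisymm h2 h1
    simp [eventsBefore]; positivity
  lower := fun i t h1 h2 => by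
    obtain rfl : t = v.length := le_antisymm h2 h1
    simp [eventsBefore]; positivity

/-- New events carry the last position, so earlier prefixes are unaffected. At the end the event
count of `x` is the maximum of its old value and `q`: `q` gives the lower bound, and either value
obeys the upper bound, as true counts never decrease even if the estimate does. -/
theorem append (hτ : 0 ≤ τ) (h : LogAccurate τ v s ℓ) (hs : s ≤ v.length) (x : Fin n) (q : ℕ)
    (hq1 : τ * q ≤ ((v ++ [x]).drop s).count x + τ / 2)
    (hq2 : (((v ++ [x]).drop s).count x : ℝ) ≤ τ * q + 3 * τ / 2) :
    LogAccurate τ (v ++ [x]) s (ℓ ++ List.replicate (q - eventsOf ℓ x) (x, v.length)) := by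
  set ℓ' := ℓ ++ List.replicate (q - eventsOf ℓ x) (x, v.length) with hℓ'
  have hold : ∀ i t, t ≤ v.length → eventsBefore ℓ' i t = eventsBefore ℓ i t := by
    intro i t ht
    simp only [hℓ', eventsBefore, List.countP_append, List.countP_replicate]
    have : ¬v.length < t := by omega
    simp [this]
  have hnew : ∀ i, i ≠ x → eventsBefore ℓ' i (v.length + 1) = eventsBefore ℓ i v.length := by
    intro i hi
    rw [h.eventsBefore_length]
    simp only [hℓ', eventsBefore, List.countP_append, List.countP_replicate]
    simp only [ne_comm.1 hi, false_and, decide_false, Bool.false_eq_true, if_false, add_zero]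
    refine List.countP_congr fun e he => ?_
    have := h.time_lt e he
    simp only [decide_eq_true_eq, and_iff_left_iff_imp]
    omega
  have hnewx : eventsBefore ℓ' x (v.length + 1) = max (eventsBefore ℓ x v.length) q := by
    have h1 : eventsBefore ℓ x (v.length + 1) = eventsOf ℓ x := by
      refine List.countP_congr fun e he => ?_
      have := h.time_lt e he
      simp only [decide_eq_true_eq, and_iff_left_iff_imp]
      omega
    have h2 : eventsBefore ℓ' x (v.length + 1) =
        eventsBefore ℓ x (v.length + 1) + (q - eventsOf ℓ x) := by
      simp [hℓ', eventsBefore, List.countP_append, List.countP_replicate]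
    rw [h2, h1, h.eventsBefore_length]
    omega
  have htake : ∀ t, t ≤ v.length → (v ++ [x]).take t = v.take t := fun t ht =>
    List.take_append_of_le_length ht
  have hlast : ((v ++ [x]).take (v.length + 1)).drop s = v.drop s ++ [x] := by
    rw [List.take_of_length_le (by simp), List.drop_append_of_le_length hs]
  rw [List.drop_append_of_le_length hs] at hq1 hq2
  have hcount : ∀ i, (v.drop s ++ [x]).count i = (v.drop s).count i + if x = i then 1 else 0 := by
    intro i
    rw [List.count_append, List.count_singleton]
    simp
  have hup := fun i => h.upper i v.length hs le_rfl
  have hlo := fun i => h.lower i v.length hs le_rfl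
  rw [List.take_length] at hup hlo
  refine ⟨?_, ?_, ?_, ?_⟩
  · intro e he
    rcases List.mem_append.1 he with he | he
    · exact h.le_time e he
    · rw [List.eq_of_mem_replicate he]; exact hs
  · intro e he
    rw [List.length_append, List.length_singleton]
    rcases List.mem_append.1 he with he | he
    · exact (h.time_lt e he).trans (Nat.lt_succ_self _)
    · rw [List.eq_of_mem_replicate he]; exact Nat.lt_succ_self _
  · intro i t hst ht
    rw [List.length_append, List.length_singleton] at ht
    rcases Nat.lt_or_ge v.length t with h1 | h1
    · obtain rfl : t = v.length + 1 := by omega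
      rw [hlast]
      by_cases hi : i = x
      · subst hi
        rw [hnewx]
        rcases max_choice (eventsBefore ℓ i v.length) q with hm | hm <;> rw [hm]
        · refine (hup i).trans ?_
          rw [hcount]
          push_cast
          split_ifs <;> linarith
        · exact hq1
      · rw [hnew i hi, hcount, if_neg (Ne.symm hi), add_zero]
        exact hup i
    · rw [hold i t h1, htake t h1]
      exact h.upper i t hst h1
  · intro i t hst ht
    rw [List.length_append, List.length_singleton] at ht
    rcases Nat.lt_or_ge v.length t with h1 | h1
    · obtain rfl : t = v.length + 1 := by omega
      rw [hlast]
      by_cases hi : i = x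
      · subst hi
        rw [hnewx]
        refine hq2.trans ?_
        have : (q : ℝ) ≤ ((max (eventsBefore ℓ i v.length) q : ℕ) : ℝ) := by
          exact_mod_cast le_max_right _ _
        have := mul_le_mul_of_nonneg_left this hτ
        linarith
      · rw [hnew i hi, hcount, if_neg (Ne.symm hi), add_zero]
        exact hlo i
    · rw [hold i t h1, htake t h1]
      exact h.lower i t hst h1

/-- An item with `e ≥ 1` events occurs at least `eτ/2` times, so `eτ² ≤ (eτ)² ≤ 4f²`. Summation
charges the log to the second moment rather than to the length of the block. -/
theorem length_le (hτ : 0 < τ) (h : LogAccurate τ v s ℓ) (hs : s ≤ v.length) :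
    (ℓ.length : ℝ) * τ ^ 2 ≤ 4 * secondMoment (v.drop s) := by
  have hlen : (ℓ.length : ℝ) = ∑ i, (eventsOf ℓ i : ℝ) := by
    clear h
    induction ℓ with
    | nil => simp [eventsOf]
    | cons e ℓ ih =>
      rw [List.length_cons, Nat.cast_add, ih]
      simp only [eventsOf, List.countP_cons, Nat.cast_add, Finset.sum_add_distrib]
      simp
  rw [hlen, Finset.sum_mul, secondMoment, Finset.mul_sum]
  refine Finset.sum_le_sum fun i _ => ?_
  have hup := h.upper i v.length hs le_rfl
  rw [List.take_length, h.eventsBefore_length] at hup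
  rcases Nat.eq_zero_or_pos (eventsOf ℓ i) with h0 | h0
  · rw [h0]
    simp
  · have h1 : (1 : ℝ) ≤ eventsOf ℓ i := by exact_mod_cast h0
    generalize (eventsOf ℓ i : ℝ) = e at h1 hup ⊢
    generalize ((v.drop s).count i : ℝ) = f at hup ⊢
    have h2 : e * τ ≤ 2 * f := by nlinarith
    calc e * τ ^ 2 ≤ e * (e * τ ^ 2) := le_mul_of_one_le_left (by positivity) h1
      _ = (e * τ) ^ 2 := by ring
      _ ≤ (2 * f) ^ 2 := by gcongr
      _ = _ := by ring

end LogAccurate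

/-! ### The two blocks at one scale -/

/-- The memory of the algorithm at one scale: the starts of the previous and of the current block,
a sketch of the current block, and the logs of both blocks. -/
structure BlockState (Sk : Type) (n : ℕ) where
  prev : ℕ
  cur : ℕ
  sketch : Sk
  prevLog : List (Fin n × ℕ)
  curLog : List (Fin n × ℕ)

namespace BlockState

variable {Sk : Type} {n : ℕ}

open Classical in
/-- Move on to a new block if the current one together with `x` is heavy. -/
noncomputable def advance (add : Sk → Fin n → Sk) (z : Sk) (heavy : Sk → Prop) (p : ℕ)
    (b : BlockState Sk n) (x : Fin n) : BlockState Sk n :=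
  if heavy (add b.sketch x) then ⟨b.cur, p, add z x, b.curLog, []⟩
  else ⟨b.prev, b.cur, add b.sketch x, b.prevLog, b.curLog⟩

/-- Log the item `x` as often as is needed to have at least `level` events of it. -/
def log (level : Sk → Fin n → ℕ) (p : ℕ) (b : BlockState Sk n) (x : Fin n) : BlockState Sk n :=
  ⟨b.prev, b.cur, b.sketch, b.prevLog,
    b.curLog ++ List.replicate (level b.sketch x - eventsOf b.curLog x) (x, p)⟩

/-- The effect of the item `x` at position `p`. -/
noncomputable def step (add : Sk → Fin n → Sk) (z : Sk) (heavy : Sk → Prop)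
    (level : Sk → Fin n → ℕ) (p : ℕ) (b : BlockState Sk n) (x : Fin n) : BlockState Sk n :=
  (b.advance add z heavy p x).log level p x

/-- The test `heavy` and the function `level`, applied to the sketches of contiguous parts of `u`,
say the right thing at the scale with squared norm about `L` and log unit `τ`. -/
structure Oracle (add : Sk → Fin n → Sk) (z : Sk) (heavy : Sk → Prop)
    (level : Sk → Fin n → ℕ) (L τ : ℝ) (u : List (Fin n)) : Prop where
  le_moment : ∀ g, g <:+: u → heavy (g.foldl add z) → 4 / 5 * L ≤ secondMoment g
  moment_le : ∀ g, g <:+: u → ¬heavy (g.foldl add z) → secondMoment g ≤ 4 / 3 * L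
  level_le : ∀ g, g <:+: u → secondMoment g ≤ 4 / 3 * L → ∀ i,
    τ * level (g.foldl add z) i ≤ g.count i + τ / 2
  le_level : ∀ g, g <:+: u → secondMoment g ≤ 4 / 3 * L → ∀ i,
    (g.count i : ℝ) ≤ τ * level (g.foldl add z) i + 3 * τ / 2

/-- What holds of the memory at one scale after the stream `v`. -/
structure Valid (add : Sk → Fin n → Sk) (z : Sk) (L τ : ℝ) (v : List (Fin n))
    (b : BlockState Sk n) : Prop where
  prev_le : b.prev ≤ b.cur
  cur_le : b.cur ≤ v.length
  sketch_eq : b.sketch = (v.drop b.cur).foldl add z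
  cur_moment : secondMoment (v.drop b.cur) ≤ 4 / 3 * L
  prev_moment : secondMoment ((v.take b.cur).drop b.prev) ≤ 4 / 3 * L
  le_moment : b.prev = 0 ∨ 4 / 5 * L ≤ secondMoment (v.drop b.prev)
  prev_log : LogAccurate τ (v.take b.cur) b.prev b.prevLog
  cur_log : LogAccurate τ v b.cur b.curLog

variable {add : Sk → Fin n → Sk} {z : Sk} {heavy : Sk → Prop} {level : Sk → Fin n → ℕ}
  {L τ : ℝ} {u v : List (Fin n)} {b : BlockState Sk n}

theorem valid_init (hL : 1 ≤ L) (hτ : 0 ≤ τ) : Valid add z L τ [] ⟨0, 0, z, [], []⟩ where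
  prev_le := le_rfl
  cur_le := le_rfl
  sketch_eq := rfl
  cur_moment := by simp [secondMoment]; linarith
  prev_moment := by simp [secondMoment]; linarith
  le_moment := Or.inl rfl
  prev_log := LogAccurate.nil (v := []) hτ
  cur_log := LogAccurate.nil (v := []) hτ

theorem secondMoment_le_of_sublist {g h : List (Fin n)} (hgh : g.Sublist h) :
    secondMoment g ≤ secondMoment h :=
  Finset.sum_le_sum fun i _ => by
    have : (g.count i : ℝ) ≤ h.count i := by exact_mod_cast hgh.count_le i
    gcongr

theorem secondMoment_singleton (x : Fin n) : secondMoment [x] = 1 := by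
  simp [secondMoment, List.count_singleton, Finset.sum_ite_eq]

/-- If the test fires, the old current block becomes the previous one without `x`, so its upper
bound survives; together with `x` it was heavy, which gives the lower bound on the suffix from its
start. The new block is `[x]`, of moment 1. If the test does not fire, that itself bounds the
extended block. -/
theorem Valid.step (hL : 1 ≤ L) (hτ : 0 ≤ τ) (ho : Oracle add z heavy level L τ u)
    (h : Valid add z L τ v b) {x : Fin n} (hv : v ++ [x] <+: u) :
    Valid add z L τ (v ++ [x]) (b.step add z heavy level v.length x) := by
  have hinf : ∀ s, (v ++ [x]).drop s <:+: u := fun s =>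
    ((v ++ [x]).drop_suffix s).isInfix.trans hv.isInfix
  have hdrop : (v ++ [x]).drop b.cur = v.drop b.cur ++ [x] :=
    List.drop_append_of_le_length h.cur_le
  have hadd : add b.sketch x = ((v ++ [x]).drop b.cur).foldl add z := by
    rw [hdrop, List.foldl_append, h.sketch_eq]; rfl
  unfold BlockState.step advance log
  split_ifs with hh
  · rw [hadd] at hh
    have hone : (v ++ [x]).drop v.length = [x] := by simp
    have hm1 : secondMoment ((v ++ [x]).drop v.length) ≤ 4 / 3 * L := by
      rw [hone, secondMoment_singleton]; linarith
    refine ⟨h.cur_le, by simp, ?_, hm1, ?_, ?_, ?_, ?_⟩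
    · simp
    · simpa using h.cur_moment
    · exact Or.inr (ho.le_moment _ (hinf _) hh)
    · simpa using h.cur_log
    · refine LogAccurate.append hτ (LogAccurate.nil hτ) le_rfl x _ ?_ ?_
      · have := ho.level_le _ (hinf v.length) hm1 x
        rw [hone] at this ⊢
        exact this
      · have := ho.le_level _ (hinf v.length) hm1 x
        rw [hone] at this ⊢
        exact this
  · rw [hadd] at hh
    have hm := ho.moment_le _ (hinf _) hh
    have htake : (v ++ [x]).take b.cur = v.take b.cur := List.take_append_of_le_length h.cur_le
    refine ⟨h.prev_le, h.cur_le.trans (by simp), hadd, hm, ?_, ?_, ?_, ?_⟩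
    · simpa only [htake] using h.prev_moment
    · refine h.le_moment.imp_right fun h1 => h1.trans (secondMoment_le_of_sublist ?_)
      exact (List.sublist_append_left v [x]).drop _
    · simpa only [htake] using h.prev_log
    · refine LogAccurate.append hτ h.cur_log h.cur_le x _ ?_ ?_
      · simp only [hadd]
        exact ho.level_le _ (hinf _) hm x
      · simp only [hadd]
        exact ho.le_level _ (hinf _) hm x

/-- The number of logged events of `i` since position `t`. -/
def recentEvents (b : BlockState Sk n) (i : Fin n) (t : ℕ) : ℕ :=
  eventsFrom (b.prevLog ++ b.curLog) i t

/-- Scaled event counts from the start of a block err by an amount in `[-3τ/2, τ/2]`. The count from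
`t` on is a difference of two of them in the block containing `t`, an error of at most `2τ`, plus
the whole current block if `t` lies in the previous one. -/
theorem Valid.abs_recentEvents_sub_le (hτ : 0 ≤ τ) (h : Valid add z L τ v b) (i : Fin n) {t : ℕ}
    (h1 : b.prev ≤ t) (h2 : t ≤ v.length) :
    |τ * b.recentEvents i t - (v.drop t).count i| ≤ 4 * τ := by
  have hsplit : b.recentEvents i t = eventsFrom b.prevLog i t + eventsFrom b.curLog i t := by
    simp [recentEvents, eventsFrom, List.countP_append]
  have hcnt : ∀ (w : List (Fin n)) (s t : ℕ), s ≤ t → t ≤ w.length →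
      ((w.drop s).count i : ℝ) = ((w.take t).drop s).count i + (w.drop t).count i := by
    intro w s t hst htw
    have : w.drop s = (w.take t).drop s ++ w.drop t := by
      conv_lhs => rw [← List.take_append_drop t w]
      rw [List.drop_append_of_le_length]
      rw [List.length_take]; omega
    rw [this, List.count_append]
    push_cast
    rfl
  have hc := eventsBefore_add_eventsFrom b.curLog i t
  have hp := eventsBefore_add_eventsFrom b.prevLog i t
  have hcu := h.cur_log.upper i v.length h.cur_le le_rfl
  have hcl := h.cur_log.lower i v.length h.cur_le le_rfl
  rw [List.take_length, h.cur_log.eventsBefore_length, ← hc] at hcu hcl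
  have hlen : (v.take b.cur).length = b.cur := by
    rw [List.length_take]; exact min_eq_left h.cur_le
  rw [hsplit, abs_le]
  rcases le_total b.cur t with h3 | h3
  · have hp0 : eventsFrom b.prevLog i t = 0 := by
      refine List.countP_eq_zero.2 fun e he => ?_
      have := h.prev_log.time_lt e he
      rw [hlen] at this
      simp only [decide_eq_true_eq, not_and, not_le]
      omega
    have hu := h.cur_log.upper i t h3 h2
    have hl := h.cur_log.lower i t h3 h2
    have := hcnt v b.cur t h3 h2
    rw [hp0]
    push_cast at hcu hcl ⊢
    constructor <;> linarith
  · have hc0 : eventsFrom b.curLog i t = eventsOf b.curLog i := by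
      refine List.countP_congr fun e he => ?_
      have := h.cur_log.le_time e he
      simp only [decide_eq_true_eq, and_iff_left_iff_imp]
      omega
    have hb0 : eventsBefore b.curLog i t = 0 := by omega
    have hu := h.prev_log.upper i t h1 (by rw [hlen]; exact h3)
    have hl := h.prev_log.lower i t h1 (by rw [hlen]; exact h3)
    have hpu := h.prev_log.upper i b.cur h.prev_le (by rw [hlen])
    have hpl := h.prev_log.lower i b.cur h.prev_le (by rw [hlen])
    have he := h.prev_log.eventsBefore_length i
    rw [hlen] at he
    rw [he, ← hp] at hpu hpl
    have e1 := hcnt v t b.cur h3 h.cur_le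
    have e2 := hcnt (v.take b.cur) b.prev t h1 (by rw [hlen]; exact h3)
    rw [List.take_take, min_eq_left h3] at hu hl e2
    rw [List.take_take, min_self] at hpu hpl
    rw [hb0] at hcu hcl
    push_cast at hcu hcl hpu hpl hu hl ⊢
    constructor <;> linarith

/-- By `(a + b)² ≤ 2a² + 2b²` applied to the two blocks, each of moment at most `4/3 * L`. -/
theorem Valid.secondMoment_drop_le (h : Valid add z L τ v b) {t : ℕ} (h1 : b.prev ≤ t) :
    secondMoment (v.drop t) ≤ 16 / 3 * L := by
  have hsub : secondMoment (v.drop t) ≤ secondMoment (v.drop b.prev) :=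
    secondMoment_le_of_sublist (List.drop_sublist_drop_left v h1)
  have hsplit : v.drop b.prev = (v.take b.cur).drop b.prev ++ v.drop b.cur := by
    conv_lhs => rw [← List.take_append_drop b.cur v]
    rw [List.drop_append_of_le_length]
    rw [List.length_take]
    exact le_min h.prev_le (h.prev_le.trans h.cur_le)
  have hle : secondMoment (v.drop b.prev) ≤
      2 * secondMoment ((v.take b.cur).drop b.prev) + 2 * secondMoment (v.drop b.cur) := by
    rw [hsplit]
    unfold secondMoment
    rw [Finset.mul_sum, Finset.mul_sum, ← Finset.sum_add_distrib]
    refine Finset.sum_le_sum fun i _ => ?_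
    rw [List.count_append]
    push_cast
    nlinarith [sq_nonneg ((((v.take b.cur).drop b.prev).count i : ℝ) - (v.drop b.cur).count i)]
  have := h.cur_moment
  have := h.prev_moment
  linarith

end BlockState

/-! ### Good seeds give a correct test and correct levels -/

/-- The sketch of `D` rows after one more item. -/
def sketchAdd {n w D : ℕ} {Ω : Type} (σ : Ω → Fin n → ℤ) (s : Fin D → Fin w → Ω)
    (Z : Fin D → Fin w → ℤ) (x : Fin n) : Fin D → Fin w → ℤ :=
  fun a j => Z a j + σ (s a j) x

theorem foldl_sketchAdd {n w D : ℕ} {Ω : Type} (σ : Ω → Fin n → ℤ) (s : Fin D → Fin w → Ω)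
    (g : List (Fin n)) : g.foldl (sketchAdd σ s) 0 = fun a => rowSketch σ (s a) g := by
  induction g using List.reverseRecOn with
  | nil => rfl
  | append_singleton g x ih =>
    rw [List.foldl_append, ih]
    funext a j
    simp [sketchAdd, rowSketch]

/-- Most rows estimate the squared norm as at least `L`. -/
def heavyTest {w D : ℕ} (L : ℝ) (Z : Fin D → Fin w → ℤ) : Prop :=
  Majority fun a => L ≤ momentEstimate (Z a)

/-- The estimated frequency of `i` in units of `τ`, rounded down. -/
noncomputable def levelEstimate {n w D : ℕ} {Ω : Type} (σ : Ω → Fin n → ℤ)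
    (s : Fin D → Fin w → Ω) (τ : ℝ) (Z : Fin D → Fin w → ℤ) (i : Fin n) : ℕ :=
  sInf {e : ℕ | ¬Majority fun a => ((e : ℝ) + 1) * τ ≤ pointEstimate σ (s a) (Z a) i}

/-- Majority votes play the role of a median: two majorities share a row, so a threshold passed by
most rows is passed in an accurate one, and a threshold not passed by most rows fails in an accurate
one. Rounding down costs the extra `τ` in the second bound. -/
theorem levelEstimate_bounds {n w D : ℕ} {Ω : Type} {σ : Ω → Fin n → ℤ}
    {s : Fin D → Fin w → Ω} {τ : ℝ} (hτ : 0 < τ) {Z : Fin D → Fin w → ℤ} {i : Fin n} {f : ℝ}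
    (hf : 0 ≤ f) (h : Majority fun a => |pointEstimate σ (s a) (Z a) i - f| ≤ τ / 2) :
    τ * levelEstimate σ s τ Z i ≤ f + τ / 2 ∧ f ≤ τ * levelEstimate σ s τ Z i + 3 * τ / 2 := by
  have hup : ∀ θ : ℝ, (Majority fun a => θ ≤ pointEstimate σ (s a) (Z a) i) → θ ≤ f + τ / 2 := by
    intro θ hθ
    obtain ⟨a, h1, h2⟩ := h.exists_and hθ
    have := (abs_le.1 h1).2
    linarith
  -- Nonemptiness matters: `sInf ∅ = 0` would carry no lower bound on the level.
  have hne : {e : ℕ | ¬Majority fun a =>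
      ((e : ℝ) + 1) * τ ≤ pointEstimate σ (s a) (Z a) i}.Nonempty := by
    obtain ⟨e, he⟩ := exists_nat_gt (f / τ)
    refine ⟨e, fun hm => ?_⟩
    have h1 := hup _ hm
    rw [div_lt_iff₀ hτ] at he
    linarith
  have hmem := Nat.sInf_mem hne
  constructor
  · rcases Nat.eq_zero_or_pos (levelEstimate σ s τ Z i) with h0 | h0
    · rw [h0, Nat.cast_zero, mul_zero]; positivity
    · have hnot := Nat.notMem_of_lt_sInf (Nat.sub_lt h0 one_pos)
      have hm := not_not.1 hnot
      have := hup _ hm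
      change (((levelEstimate σ s τ Z i - 1 : ℕ) : ℝ) + 1) * τ ≤ _ at this
      rw [Nat.cast_pred h0, sub_add_cancel] at this
      linarith
  · obtain ⟨a, h1, h2⟩ := h.exists_and_not hmem
    have := (abs_le.1 h1).1
    rw [not_le] at h2
    change _ < ((levelEstimate σ s τ Z i : ℝ) + 1) * τ at h2
    linarith

/-- `w ≥ 512` makes the moment estimate accurate within a factor `1 ± 1/4`, whence `4/5` and `4/3`.
For moment at most `4/3 * L`, the squared point error is at most `64/3 * L / w`, below `τ² / 4` by
`hL`. -/
theorem GoodSeed.oracle {n w D : ℕ} {Ω : Type} {σ : Ω → Fin n → ℤ} {s : Fin D → Fin w → Ω}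
    {u : List (Fin n)} (h : GoodSeed σ s u) {L τ : ℝ} (hτ : 0 < τ) (hw : 512 ≤ w)
    (hL : 100 * L ≤ w * τ ^ 2) :
    BlockState.Oracle (sketchAdd σ s) 0 (heavyTest L) (levelEstimate σ s τ) L τ u := by
  have hw' : (512 : ℝ) ≤ w := by exact_mod_cast hw
  have hw0 : (0 : ℝ) < w := by linarith
  have hmom : ∀ g, g <:+: u → Majority fun a =>
      |momentEstimate (rowSketch σ (s a) g) - secondMoment g| ≤ secondMoment g / 4 := by
    intro g hg
    refine (h g hg).2.mono fun a ha => abs_le_of_sq_le_sq (ha.trans ?_)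
      (by have := secondMoment_nonneg g; positivity)
    have h1 : (32 : ℝ) / w ≤ 1 / 16 := by
      rw [div_le_div_iff₀ hw0 (by norm_num)]; linarith
    calc 32 / w * secondMoment g ^ 2 ≤ 1 / 16 * secondMoment g ^ 2 := by gcongr
      _ = _ := by ring
  have hlevel : ∀ g, g <:+: u → secondMoment g ≤ 4 / 3 * L → ∀ i,
      τ * levelEstimate σ s τ (g.foldl (sketchAdd σ s) 0) i ≤ g.count i + τ / 2 ∧
      (g.count i : ℝ) ≤ τ * levelEstimate σ s τ (g.foldl (sketchAdd σ s) 0) i + 3 * τ / 2 := by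
    intro g hg hm i
    rw [foldl_sketchAdd]
    refine levelEstimate_bounds hτ (Nat.cast_nonneg _) (((h g hg).1 i).mono fun a ha =>
      abs_le_of_sq_le_sq (ha.trans ?_) (by positivity))
    rw [div_mul_eq_mul_div, div_le_iff₀ hw0]
    nlinarith [sq_nonneg τ]
  refine ⟨fun g hg hh => ?_, fun g hg hh => ?_, fun g hg hm i => (hlevel g hg hm i).1,
    fun g hg hm i => (hlevel g hg hm i).2⟩
  · rw [foldl_sketchAdd] at hh
    obtain ⟨a, h1, h2⟩ := (hmom g hg).exists_and hh
    have := (abs_le.1 h1).2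
    linarith
  · rw [foldl_sketchAdd] at hh
    obtain ⟨a, h1, h2⟩ := (hmom g hg).exists_and_not hh
    have := (abs_le.1 h1).1
    rw [not_le] at h2
    linarith

/-! ### All scales together -/

/-- The full memory content: the random seeds, the number of items seen, and one block state for
each of the scales `0, …, K`. -/
structure SketchState (Ω : Type) (n w D K : ℕ) where
  seed : Fin D → Fin w → Ω
  time : ℕ
  blocks : Fin (K + 1) → BlockState (Fin D → Fin w → ℤ) n

namespace SketchState

variable {Ω : Type} {n w D K : ℕ}

/-- The memory content before the first item. -/
def start (n K : ℕ) (s : Fin D → Fin w → Ω) : SketchState Ω n w D K :=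
  ⟨s, 0, fun _ => ⟨0, 0, 0, [], []⟩⟩

/-- Processing one item. -/
noncomputable def step (σ : Ω → Fin n → ℤ) (δ : ℚ) (S : SketchState Ω n w D K) (x : Fin n) :
    SketchState Ω n w D K :=
  ⟨S.seed, S.time + 1, fun k => (S.blocks k).step (sketchAdd σ S.seed) 0
    (heavyTest (4 ^ (k : ℕ))) (levelEstimate σ S.seed (δ * 2 ^ (k : ℕ))) S.time x⟩

/-- The finest scale whose two blocks cover the positions from `t` on. -/
noncomputable def scale (S : SketchState Ω n w D K) (t : ℕ) : Fin (K + 1) :=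
  Classical.epsilon fun k => (S.blocks k).prev ≤ t ∧ ∀ j < k, t < (S.blocks j).prev

open Classical in
/-- The reported set of heavy hitters for the window size `W` and their estimated frequencies. -/
noncomputable def heavyHitters (W : ℕ) (δ : ℚ) (η : ℝ) (S : SketchState Ω n w D K) :
    HeavyHitterReport n :=
  let k := S.scale (S.time - W)
  let g : Fin n → ℚ := fun i => δ * 2 ^ (k : ℕ) * (S.blocks k).recentEvents i (S.time - W)
  ⟨Finset.univ.filter fun i => 3 / 8 * η * 2 ^ (k : ℕ) ≤ (g i : ℝ), g⟩

theorem foldl_step_seed_time (σ : Ω → Fin n → ℤ) (δ : ℚ) (s : Fin D → Fin w → Ω)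
    (v : List (Fin n)) :
    (v.foldl (step σ δ) (start n K s)).seed = s ∧
      (v.foldl (step σ δ) (start n K s)).time = v.length := by
  induction v using List.reverseRecOn with
  | nil => exact ⟨rfl, rfl⟩
  | append_singleton v x ih =>
    rw [List.foldl_append, List.length_append]
    exact ⟨ih.1, congrArg (· + 1) ih.2⟩

theorem valid_foldl_step {σ : Ω → Fin n → ℤ} {δ : ℚ} {s : Fin D → Fin w → Ω}
    {u : List (Fin n)} (h : GoodSeed σ s u) (hδ : 0 < δ) (hw : 512 ≤ w)
    (hwδ : 100 ≤ (w : ℝ) * δ ^ 2) (k : Fin (K + 1)) (v : List (Fin n)) (hv : v <+: u) :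
    ((v.foldl (step σ δ) (start n K s)).blocks k).Valid (sketchAdd σ s) 0 (4 ^ (k : ℕ))
      (δ * 2 ^ (k : ℕ)) v := by
  have hδ' : (0 : ℝ) < δ := by exact_mod_cast hδ
  have hτ : (0 : ℝ) < δ * 2 ^ (k : ℕ) := by positivity
  have hL : (1 : ℝ) ≤ 4 ^ (k : ℕ) := one_le_pow₀ (by norm_num)
  have ho := h.oracle (L := 4 ^ (k : ℕ)) hτ hw (by
    have : ((δ : ℝ) * 2 ^ (k : ℕ)) ^ 2 = δ ^ 2 * 4 ^ (k : ℕ) := by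
      rw [mul_pow, ← pow_mul, mul_comm (k : ℕ) 2, pow_mul]; norm_num
    rw [this, ← mul_assoc]
    gcongr)
  induction v using List.reverseRecOn with
  | nil => exact BlockState.valid_init hL hτ.le
  | append_singleton v x ih =>
    have hst := foldl_step_seed_time (K := K) σ δ s v
    have := (ih ((List.prefix_append v [x]).trans hv)).step hL hτ.le ho hv
    rw [List.foldl_append]
    simp only [List.foldl_cons, List.foldl_nil, step]
    rw [hst.1, hst.2]
    exact this

end SketchState

/-! ### Correctness of the report -/

/-- The hypotheses give `L ≤ 9/4 ‖f‖` and `‖f‖ ≤ 7/3 L`, so light items have `f i ≤ 7/24 ηL` and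
heavy ones `f i ≥ 4/9 ηL`; the cutoff `3/8` separates them with room for the error, which is at most
`ηL/200`. Reported items exceed `η‖f‖/8`, which turns the additive error into a relative one of at
most `0.36 ν`. -/
theorem HeavyHitterReport.isCorrect_of_abs_le {n : ℕ} {R : HeavyHitterReport n} {ν η L : ℝ}
    {f : EuclideanSpace ℝ (Fin n)} (hν : ν ∈ Set.Ioo (0 : ℝ) (1 / 4)) (hη : 0 < η) (hL : 0 < L)
    (hlow : L ^ 2 / 5 ≤ ‖f‖ ^ 2) (hupp : ‖f‖ ^ 2 ≤ 16 / 3 * L ^ 2)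
    (hR : ∀ i, i ∈ R.items ↔ 3 / 8 * η * L ≤ R.estimate i)
    (hest : ∀ i, |(R.estimate i : ℝ) - f i| ≤ ν * η * L / 50) :
    R.IsCorrect ν η f := by
  obtain ⟨hν0, hν1⟩ := hν
  set N := ‖f‖
  have hN0 : 0 ≤ N := norm_nonneg f
  have h1 : L ≤ 9 / 4 * N := by nlinarith
  have h2 : N ≤ 7 / 3 * L := by nlinarith
  have hN : 0 < N := by linarith
  have herr : ν * η * L / 50 ≤ 9 / 200 * (ν * (η * N)) := by
    have : ν * η * L ≤ ν * η * (9 / 4 * N) := by gcongr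
    linarith
  have hηN : 0 < η * N := mul_pos hη hN
  have hνηN : ν * (η * N) ≤ 1 / 4 * (η * N) := by gcongr
  have hηL : η * L ≤ 9 / 4 * (η * N) := by nlinarith
  have hηL' : η * N ≤ 7 / 3 * (η * L) := by nlinarith
  have hlight : ∀ i, f i ≤ η / 8 * N → i ∉ R.items := by
    intro i hi
    rw [hR, not_le]
    have := (abs_le.1 (hest i)).2
    linarith
  refine ⟨fun i hi => ?_, hlight, fun i hi => ?_⟩
  · rw [hR]
    have := (abs_le.1 (hest i)).1
    linarith
  · have hfi : η / 8 * N < f i := by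
      by_contra! hcon
      exact hlight i hcon hi
    have herr' : 9 / 200 * (ν * (η * N)) ≤ 36 / 100 * (ν * f i) := by
      have : ν * (η / 8 * N) ≤ ν * f i := by gcongr
      linarith
    have hf0 : 0 < f i := lt_of_le_of_lt (by positivity) hfi
    have ha := abs_le.1 (hest i)
    constructor
    · have hg : f i * (1 - 36 / 100 * ν) ≤ R.estimate i := by linarith
      calc f i ≤ (1 + ν) * (f i * (1 - 36 / 100 * ν)) := by
            have : 0 ≤ f i * (ν * (64 / 100 - 36 / 100 * ν)) := by
              apply mul_nonneg hf0.le (mul_nonneg hν0.le _); linarith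
            linarith
        _ ≤ _ := by gcongr
    · have := mul_pos hν0 hf0
      linarith

theorem norm_windowFreq_sq {n : ℕ} (W : ℕ) (u : List (Fin n)) :
    ‖windowFreq W u‖ ^ 2 = secondMoment (u.drop (u.length - W)) := by
  rw [EuclideanSpace.norm_sq_eq]
  simp [windowFreq, activeWindow, secondMoment]

theorem length_le_secondMoment {n : ℕ} (g : List (Fin n)) : (g.length : ℝ) ≤ secondMoment g := by
  have h : g.length = ∑ i, g.count i := by
    simpa using (Multiset.sum_count_eq_card (s := Finset.univ) (m := (g : Multiset (Fin n)))
      (fun a _ => Finset.mem_univ a)).symm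
  rw [h, secondMoment]
  push_cast
  refine Finset.sum_le_sum fun i _ => ?_
  exact_mod_cast Nat.le_self_pow two_ne_zero (g.count i)

theorem secondMoment_le_length_sq {n : ℕ} (g : List (Fin n)) :
    secondMoment g ≤ (g.length : ℝ) ^ 2 := by
  have h : g.length = ∑ i, g.count i := by
    simpa using (Multiset.sum_count_eq_card (s := Finset.univ) (m := (g : Multiset (Fin n)))
      (fun a _ => Finset.mem_univ a)).symm
  rw [h, secondMoment]
  push_cast
  exact Finset.sum_sq_le_sq_sum_of_nonneg fun i _ => Nat.cast_nonneg _

/-- Scale `K` is too coarse ever to discard the start of the stream, so a covering scale exists. If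
the finest one is `k > 0`, scale `k - 1` starts after the window does and still carries `4/5 *
4^(k-1) = 4^k / 5`; for `k = 0` a nonempty window has moment at least 1. The error `4τ` is at most
`νη 2^k / 50` by `hδν`. -/
theorem SketchState.heavyHitters_isCorrect {Ω : Type} {n w D K : ℕ} {σ : Ω → Fin n → ℤ} {δ : ℚ}
    {s : Fin D → Fin w → Ω} {u : List (Fin n)} (h : GoodSeed σ s u) (hδ : 0 < δ) (hw : 512 ≤ w)
    (hwδ : 100 ≤ (w : ℝ) * δ ^ 2) {W : ℕ} (hW : 0 < W) (hu : u ≠ []) {ν η : ℝ}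
    (hν : ν ∈ Set.Ioo (0 : ℝ) (1 / 4)) (hη : 0 < η) (hδν : (δ : ℝ) ≤ ν * η / 200)
    (hK : (u.length : ℝ) ^ 2 < 4 / 5 * 4 ^ K) :
    ((u.foldl (step σ δ) (start n K s)).heavyHitters W δ η).IsCorrect ν η (windowFreq W u) := by
  set S := u.foldl (step σ δ) (start n K s)
  have hval : ∀ k : Fin (K + 1), (S.blocks k).Valid (sketchAdd σ s) 0 (4 ^ (k : ℕ))
      (δ * 2 ^ (k : ℕ)) u := fun k => valid_foldl_step h hδ hw hwδ k u (List.prefix_refl u)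
  have hδ' : (0 : ℝ) < δ := by exact_mod_cast hδ
  have htime : S.time = u.length := (foldl_step_seed_time σ δ s u).2
  set t := u.length - W with ht
  have hex : ∃ k : Fin (K + 1), (S.blocks k).prev ≤ t ∧ ∀ j < k, t < (S.blocks j).prev := by
    have hlast : (S.blocks (Fin.last K)).prev ≤ t := by
      rcases (hval (Fin.last K)).le_moment with h0 | h0
      · rw [h0]; exact Nat.zero_le _
      · exfalso
        have h1 := BlockState.secondMoment_le_of_sublist
          (List.drop_sublist (S.blocks (Fin.last K)).prev u)
        have h2 := secondMoment_le_length_sq u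
        rw [Fin.val_last] at h0
        linarith
    have hne : (Finset.univ.filter fun k : Fin (K + 1) => (S.blocks k).prev ≤ t).Nonempty :=
      ⟨Fin.last K, by simp [hlast]⟩
    refine ⟨Finset.min' _ hne, (Finset.mem_filter.1 (Finset.min'_mem _ hne)).2, fun j hj => ?_⟩
    by_contra! hcon
    exact absurd (Finset.min'_le _ j (by simp [hcon])) (not_le.2 hj)
  have hk := Classical.epsilon_spec hex
  change (S.blocks (S.scale t)).prev ≤ t ∧ ∀ j < S.scale t, t < (S.blocks j).prev at hk
  set k := S.scale t
  have h4 : ((2 : ℝ) ^ (k : ℕ)) ^ 2 = 4 ^ (k : ℕ) := by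
    rw [← pow_mul, mul_comm (k : ℕ) 2, pow_mul]; norm_num
  refine HeavyHitterReport.isCorrect_of_abs_le (L := 2 ^ (k : ℕ)) hν hη (by positivity) ?_ ?_ ?_ ?_
  · rw [norm_windowFreq_sq, h4]
    rcases Nat.eq_zero_or_pos (k : ℕ) with h0 | h0
    · have hlen := length_le_secondMoment (u.drop t)
      have hpos : 1 ≤ (u.drop t).length := by
        have := List.length_pos_iff.2 hu
        rw [List.length_drop]; omega
      have : (1 : ℝ) ≤ (u.drop t).length := by exact_mod_cast hpos
      rw [h0]
      change (4 : ℝ) ^ 0 / 5 ≤ secondMoment (u.drop t)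
      norm_num
      linarith
    · let j : Fin (K + 1) := ⟨k - 1, by have := k.2; omega⟩
      have hj := hk.2 j (Fin.lt_def.2 (Nat.sub_lt h0 one_pos))
      rcases (hval j).le_moment with h1 | h1
      · omega
      · have h2 : secondMoment (u.drop (S.blocks j).prev) ≤ secondMoment (u.drop t) :=
          BlockState.secondMoment_le_of_sublist (List.drop_sublist_drop_left u hj.le)
        have h3 : (4 : ℝ) ^ (k : ℕ) = 4 * 4 ^ (j : ℕ) := by
          rw [← pow_succ']
          congr 1
          simp only [j]
          omega
        rw [h3]
        change _ ≤ secondMoment (u.drop t)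
        linarith
  · rw [norm_windowFreq_sq, h4]
    exact (hval k).secondMoment_drop_le hk.1
  · intro i
    simp only [heavyHitters, Finset.mem_filter, Finset.mem_univ, true_and, htime]
    rfl
  · intro i
    have hrec := (hval k).abs_recentEvents_sub_le (by positivity) i hk.1 (Nat.sub_le _ _)
    have he : (((S.heavyHitters W δ η).estimate i : ℚ) : ℝ) =
        δ * 2 ^ (k : ℕ) * (S.blocks k).recentEvents i t := by
      simp only [heavyHitters, htime]
      push_cast
      rfl
    rw [he]
    have hf : windowFreq W u i = ((u.drop t).count i : ℝ) := rfl
    rw [hf]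
    refine hrec.trans ?_
    have : (δ : ℝ) * 2 ^ (k : ℕ) ≤ ν * η / 200 * 2 ^ (k : ℕ) := by gcongr
    linarith

/-! ### Encoding the memory in bits -/

/-- Encoding of the numbers up to `T`. -/
def natCode (T t : ℕ) : Fin (T + 1) := Fin.ofNat (T + 1) t

theorem natCode_injOn (T : ℕ) : Set.InjOn (natCode T) {t | t ≤ T} := by
  intro a ha b hb h
  have := congrArg Fin.val h
  simp only [natCode, Fin.val_ofNat] at this
  rwa [Nat.mod_eq_of_lt (Nat.lt_succ_of_le ha), Nat.mod_eq_of_lt (Nat.lt_succ_of_le hb)] at this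

/-- Encoding of the integers of absolute value up to `T`. -/
def intCode (T : ℕ) (z : ℤ) : Fin (2 * T + 1) := natCode (2 * T) (z + T).toNat

theorem intCode_injOn (T : ℕ) : Set.InjOn (intCode T) {z | |z| ≤ T} := by
  intro a ha b hb h
  simp only [Set.mem_ofPred_eq, abs_le] at ha hb
  have := natCode_injOn (2 * T) (x₁ := (a + T).toNat) (by simp; omega)
    (x₂ := (b + T).toNat) (by simp; omega) h
  omega

/-- Encoding of the logs of length up to `Q` with times up to `T`. -/
def logCode {n : ℕ} (T Q : ℕ) (ℓ : List (Fin n × ℕ)) : Fin Q → Option (Fin n × Fin (T + 1)) :=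
  fun q => (ℓ[(q : ℕ)]?).map fun e => (e.1, natCode T e.2)

theorem logCode_injOn {n : ℕ} (T Q : ℕ) :
    Set.InjOn (logCode (n := n) T Q) {ℓ | ℓ.length ≤ Q ∧ ∀ e ∈ ℓ, e.2 ≤ T} := by
  rintro ℓ ⟨h1, h2⟩ ℓ' ⟨h1', h2'⟩ h
  refine List.ext_getElem? fun q => ?_
  rcases Nat.lt_or_ge q Q with hq | hq
  · have := congrFun h ⟨q, hq⟩
    simp only [logCode] at this
    cases ha : ℓ[q]? with
    | none =>
      rw [ha] at this
      cases hb : ℓ'[q]? with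
      | none => rfl
      | some e => rw [hb] at this; simp at this
    | some e =>
      rw [ha] at this
      cases hb : ℓ'[q]? with
      | none => rw [hb] at this; simp at this
      | some e' =>
        rw [hb] at this
        simp only [Option.map_some, Option.some.injEq, Prod.mk.injEq] at this
        rw [Option.some.injEq]
        exact Prod.ext this.1 (natCode_injOn T (h2 e (List.mem_of_getElem? ha))
          (h2' e' (List.mem_of_getElem? hb)) this.2)
  · rw [List.getElem?_eq_none (h1.trans hq), List.getElem?_eq_none (h1'.trans hq)]

/-- The codes of the block states. -/
abbrev BlockCode (n w D T Q : ℕ) : Type :=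
  (Fin (T + 1) × Fin (T + 1)) × (Fin D → Fin w → Fin (2 * T + 1)) ×
    (Fin Q → Option (Fin n × Fin (T + 1))) × (Fin Q → Option (Fin n × Fin (T + 1)))

/-- Encoding of the block states with bounded entries. -/
def BlockState.code {n w D : ℕ} (T Q : ℕ) (b : BlockState (Fin D → Fin w → ℤ) n) :
    BlockCode n w D T Q :=
  ((natCode T b.prev, natCode T b.cur), fun a j => intCode T (b.sketch a j),
    logCode T Q b.prevLog, logCode T Q b.curLog)

/-- The entries of a block state are bounded by `T` and the lengths of its logs by `Q`. -/
structure BlockState.IsBounded {n w D : ℕ} (T Q : ℕ) (b : BlockState (Fin D → Fin w → ℤ) n) :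
    Prop where
  prev_le : b.prev ≤ T
  cur_le : b.cur ≤ T
  sketch_le : ∀ a j, |b.sketch a j| ≤ T
  prevLog_le : b.prevLog.length ≤ Q ∧ ∀ e ∈ b.prevLog, e.2 ≤ T
  curLog_le : b.curLog.length ≤ Q ∧ ∀ e ∈ b.curLog, e.2 ≤ T

theorem BlockState.code_injOn {n w D : ℕ} (T Q : ℕ) :
    Set.InjOn (BlockState.code (n := n) (w := w) (D := D) T Q) {b | b.IsBounded T Q} := by
  rintro ⟨p, c, Z, l, l'⟩ h ⟨p', c', Z', m, m'⟩ h' heq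
  simp only [BlockState.code, Prod.mk.injEq] at heq
  obtain ⟨⟨h1, h2⟩, h3, h4, h5⟩ := heq
  obtain rfl := natCode_injOn T h.prev_le h'.prev_le h1
  obtain rfl := natCode_injOn T h.cur_le h'.cur_le h2
  obtain rfl := logCode_injOn T Q h.prevLog_le h'.prevLog_le h4
  obtain rfl := logCode_injOn T Q h.curLog_le h'.curLog_le h5
  have : Z = Z' := funext fun a => funext fun j =>
    intCode_injOn T (h.sketch_le a j) (h'.sketch_le a j) (congrFun (congrFun h3 a) j)
  rw [this]

/-- Encoding of the memory contents with bounded entries. -/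
def SketchState.code {Ω : Type} {n w D K : ℕ} (T Q : ℕ) (S : SketchState Ω n w D K) :
    (Fin D → Fin w → Ω) × Fin (T + 1) × (Fin (K + 1) → BlockCode n w D T Q) :=
  (S.seed, natCode T S.time, fun k => (S.blocks k).code T Q)

theorem SketchState.code_injOn {Ω : Type} {n w D K : ℕ} (T Q : ℕ) :
    Set.InjOn (SketchState.code (Ω := Ω) (n := n) (w := w) (D := D) (K := K) T Q)
      {S | S.time ≤ T ∧ ∀ k, (S.blocks k).IsBounded T Q} := by
  rintro ⟨s, t, b⟩ ⟨h1, h2⟩ ⟨s', t', b'⟩ ⟨h1', h2'⟩ heq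
  simp only [SketchState.code, Prod.mk.injEq] at heq
  obtain ⟨rfl, e1, e2⟩ := heq
  obtain rfl := natCode_injOn T h1 h1' e1
  have : b = b' := funext fun k => BlockState.code_injOn T Q (h2 k) (h2' k) (congrFun e2 k)
  rw [this]

theorem IsSignFamily.abs_rowSketch_le {n w : ℕ} {Ω : Type} [Fintype Ω] {σ : Ω → Fin n → ℤ}
    (hσ : IsSignFamily σ) (ρ : Fin w → Ω) (g : List (Fin n)) (j : Fin w) :
    |rowSketch σ ρ g j| ≤ g.length := by
  induction g with
  | nil => simp [rowSketch]
  | cons x g ih =>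
    simp only [rowSketch, List.map_cons, List.sum_cons, List.length_cons, Nat.cast_add,
      Nat.cast_one] at ih ⊢
    have := abs_add_le (σ (ρ j) x) (g.map (σ (ρ j))).sum
    have := hσ.abs_eq_one (ρ j) x
    linarith

/-- The width `w` also serves as the log capacity: `length_le` gives at most `16/3 / δ²` events, and
`w ≥ 100 / δ²`. -/
theorem SketchState.isBounded_foldl_step {Ω : Type} [Fintype Ω] {n w D K T : ℕ}
    {σ : Ω → Fin n → ℤ} (hσ : IsSignFamily σ) {δ : ℚ} {s : Fin D → Fin w → Ω}
    {u v : List (Fin n)} (h : GoodSeed σ s u) (hδ : 0 < δ) (hw : 512 ≤ w)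
    (hwδ : 100 ≤ (w : ℝ) * δ ^ 2) (hT : u.length ≤ T) (hv : v <+: u) (k : Fin (K + 1)) :
    ((v.foldl (step σ δ) (start n K s)).blocks k).IsBounded T w := by
  have hval := valid_foldl_step (K := K) h hδ hw hwδ k v hv
  set b := (v.foldl (step σ δ) (start n K s)).blocks k
  have hvT : v.length ≤ T := hv.length_le.trans hT
  have hδ' : (0 : ℝ) < δ := by exact_mod_cast hδ
  have hτ : (0 : ℝ) < δ * 2 ^ (k : ℕ) := by positivity
  have hlen : ∀ (v' : List (Fin n)) (s' : ℕ) (ℓ : List (Fin n × ℕ)),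
      LogAccurate (δ * 2 ^ (k : ℕ)) v' s' ℓ → s' ≤ v'.length →
      secondMoment (v'.drop s') ≤ 4 / 3 * 4 ^ (k : ℕ) → ℓ.length ≤ w := by
    intro v' s' ℓ hℓ hs' hm
    have h1 := hℓ.length_le hτ hs'
    have h2 : ((δ : ℝ) * 2 ^ (k : ℕ)) ^ 2 = δ ^ 2 * 4 ^ (k : ℕ) := by
      rw [mul_pow, ← pow_mul, mul_comm (k : ℕ) 2, pow_mul]; norm_num
    have h3 : (4 : ℝ) ^ (k : ℕ) * (ℓ.length * δ ^ 2) ≤ 4 ^ (k : ℕ) * (16 / 3) := by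
      rw [h2] at h1; linarith
    have h4 := le_of_mul_le_mul_left h3 (by positivity)
    have h5 : (ℓ.length : ℝ) * δ ^ 2 ≤ w * δ ^ 2 := by linarith
    exact_mod_cast le_of_mul_le_mul_right h5 (by positivity)
  have hclen : (v.take b.cur).length = b.cur := by
    rw [List.length_take]; exact min_eq_left hval.cur_le
  refine ⟨hval.prev_le.trans (hval.cur_le.trans hvT), hval.cur_le.trans hvT, fun a j => ?_,
    ⟨?_, fun e he => ?_⟩, ⟨?_, fun e he => ?_⟩⟩
  · rw [hval.sketch_eq, foldl_sketchAdd]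
    refine (hσ.abs_rowSketch_le (s a) _ j).trans ?_
    rw [List.length_drop]
    exact_mod_cast (Nat.sub_le _ _).trans hvT
  · exact hlen _ _ _ hval.prev_log (by rw [hclen]; exact hval.prev_le) hval.prev_moment
  · have := hval.prev_log.time_lt e he
    rw [hclen] at this
    exact this.le.trans (hval.cur_le.trans hvT)
  · exact hlen _ _ _ hval.cur_log hval.cur_le hval.cur_moment
  · exact (hval.cur_log.time_lt e he).le.trans hvT

theorem card_code_le {Ω : Type} [Fintype Ω] {n w D K T B r : ℕ}
    (hΩ : Fintype.card (Fin D → Fin w → Ω) = 2 ^ r) (h1 : 2 * T + 1 ≤ 2 ^ B)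
    (h2 : n * (T + 1) + 1 ≤ 2 ^ B) :
    Fintype.card ((Fin D → Fin w → Ω) × Fin (T + 1) × (Fin (K + 1) → BlockCode n w D T w)) ≤
      2 ^ (r + (B + (2 * B + (B * w * D + (B * w + B * w))) * (K + 1))) := by
  rw [Fintype.card_prod, hΩ]
  simp only [Fintype.card_prod, Fintype.card_fun, Fintype.card_fin, Fintype.card_option]
  rw [pow_add 2 r, pow_add 2 B, pow_mul 2 _ (K + 1), pow_add 2 (2 * B), pow_add 2 (B * w * D),
    pow_add 2 (B * w), pow_mul 2 (B * w) D, pow_mul 2 B w, two_mul B, pow_add 2 B]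
  have h3 : T + 1 ≤ 2 ^ B := by omega
  gcongr

/-! ### Choice of parameters and the space bound -/

/-- The seeds are counted twice in the space, once as coins and once as stored memory. By `hk` the
amplification `4^k` absorbs the union bound and leaves failure probability at most `1 / N`. -/
theorem exists_heavyHitters_algorithm {n l k K T B : ℕ} (hl : l ≠ 0) (hn : n ≤ 2 ^ l)
    (h1 : 2 * T + 1 ≤ 2 ^ B) (h2 : n * (T + 1) + 1 ≤ 2 ^ B) (hK : (T : ℝ) ^ 2 < 4 / 5 * 4 ^ K)
    {W w : ℕ} (hW : 0 < W) {δ : ℚ} {ν η : ℝ} (hδ : 0 < δ) (hw : 512 ≤ w)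
    (hwδ : 100 ≤ (w : ℝ) * δ ^ 2) (hν : ν ∈ Set.Ioo (0 : ℝ) (1 / 4)) (hη : 0 < η)
    (hδν : (δ : ℝ) ≤ ν * η / 200) {N : ℕ} (hN : 0 < N)
    (hk : (T + 1) ^ 2 * (n + 1) * N ≤ 4 ^ k) :
    ∃ A : StreamingAlgorithm n (HeavyHitterReport n),
      A.space = 2 * (2 * l * w * (2 * k)) +
        (B + (2 * B + (B * w * (2 * k) + (B * w + B * w))) * (K + 1)) ∧
      ∀ u : List (Fin n), u ≠ [] → u.length ≤ T →
        ENNReal.ofReal (1 - 1 / N) ≤ A.prob u (fun R => R.IsCorrect ν η (windowFreq W u)) := by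
  classical
  obtain ⟨σ, hσ⟩ := exists_isSignFamily hl hn
  have hΩ : Fintype.card (Fin (2 * k) → Fin w → (Fin (2 * l) → Bool)) =
      2 ^ (2 * l * w * (2 * k)) := by
    simp [← pow_mul]
  have : Nonempty (SketchState (Fin (2 * l) → Bool) n w (2 * k) K) :=
    ⟨SketchState.start n K fun _ _ _ => false⟩
  obtain ⟨A, hA, hprob⟩ := StreamingAlgorithm.exists_of_fold hΩ (card_code_le hΩ h1 h2)
    (SketchState.start n K) (SketchState.step σ δ) (SketchState.heavyHitters W δ η) _
    (SketchState.code T w) (SketchState.code_injOn T w)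
  refine ⟨A, by rw [hA]; ring, fun u hu hlen => ?_⟩
  refine le_trans ?_ (hprob u _ (Finset.univ.filter fun s => GoodSeed σ s u) fun s hs => ?_)
  · set G := Finset.univ.filter fun s : Fin (2 * k) → Fin w → (Fin (2 * l) → Bool) =>
      GoodSeed σ s u
    have hbad := hσ.card_not_goodSeed (w := w) (by omega) k u
    have hsplit := Finset.card_filter_add_card_filter_not (s := Finset.univ)
      (fun s : Fin (2 * k) → Fin w → (Fin (2 * l) → Bool) => GoodSeed σ s u)
    rw [Finset.card_univ, hΩ] at hsplit
    rw [hΩ] at hbad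
    set bad := (Finset.univ.filter fun s : Fin (2 * k) → Fin w → (Fin (2 * l) → Bool) =>
      ¬GoodSeed σ s u).card
    set M := 2 ^ (2 * l * w * (2 * k)) with hM
    have hMpos : 0 < M := by positivity
    have hb : N * bad ≤ M := by
      refine Nat.le_of_mul_le_mul_left ?_ (show 0 < 4 ^ k by positivity)
      calc 4 ^ k * (N * bad) = N * (4 ^ k * bad) := by ring
        _ ≤ N * ((u.length + 1) ^ 2 * (n + 1) * M) := by gcongr
        _ ≤ N * ((T + 1) ^ 2 * (n + 1) * M) := by gcongr
        _ = ((T + 1) ^ 2 * (n + 1) * N) * M := by ring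
        _ ≤ _ := by gcongr
    have hG : (1 - 1 / N : ℝ) ≤ G.card / M := by
      have hN' : (0 : ℝ) < N := by exact_mod_cast hN
      have hM' : (0 : ℝ) < M := by exact_mod_cast hMpos
      have e1 : (G.card : ℝ) + bad = M := by exact_mod_cast hsplit
      have e2 : (N : ℝ) * bad ≤ M := by exact_mod_cast hb
      rw [le_div_iff₀ hM', ← e1, sub_mul, one_mul, e1]
      have : (bad : ℝ) ≤ 1 / N * M := by
        rw [div_mul_eq_mul_div, one_mul, le_div_iff₀ hN']; linarith
      linarith
    refine (ENNReal.ofReal_le_ofReal hG).trans (le_of_eq ?_)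
    rw [ENNReal.ofReal_div_of_pos (by exact_mod_cast hMpos), ENNReal.ofReal_natCast,
      ENNReal.ofReal_natCast, hM]
    push_cast
    rfl
  · have hgood := (Finset.mem_filter.1 hs).2
    refine ⟨fun v hv => ⟨?_, fun j => ?_⟩, ?_⟩
    · rw [(SketchState.foldl_step_seed_time σ δ s v).2]
      exact hv.length_le.trans hlen
    · exact SketchState.isBounded_foldl_step hσ hgood hδ hw hwδ hlen hv j
    · refine SketchState.heavyHitters_isCorrect hgood hδ hw hwδ hW hu hν hη hδν
        (lt_of_le_of_lt ?_ hK)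
      gcongr

/-- Rounding up costs at most one `log 2 ≤ log n`, and `2 / log 2 < 3`. -/
theorem clog_two_le_three_mul_log {n : ℕ} (hn : 2 ≤ n) : (Nat.clog 2 n : ℝ) ≤ 3 * Real.log n := by
  have h1 : 2 ^ (Nat.clog 2 n - 1) < n := Nat.pow_pred_clog_lt_self one_lt_two hn
  have hpos : 0 < Nat.clog 2 n := Nat.clog_pos one_lt_two hn
  have h2 : ((Nat.clog 2 n - 1 : ℕ) : ℝ) * Real.log 2 ≤ Real.log n := by
    rw [← Real.log_pow]
    refine Real.log_le_log (by positivity) ?_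
    exact_mod_cast h1.le
  rw [Nat.cast_pred hpos] at h2
  have h3 : Real.log 2 ≤ Real.log n := Real.log_le_log (by norm_num) (by exact_mod_cast hn)
  have h4 := Real.log_two_gt_d9
  have hl : (0 : ℝ) ≤ Nat.clog 2 n := Nat.cast_nonneg _
  nlinarith

theorem mainTheorem2 (c d : ℕ) :
    ∃ K : ℝ, 0 < K ∧
      ∀ (n W : ℕ), 0 < n → 0 < W →
      ∀ (ν η : ℝ), ν ∈ Set.Ioo (0 : ℝ) (1 / 4) → η ∈ Set.Ioo (0 : ℝ) 1 →
      ∃ A : StreamingAlgorithm n (HeavyHitterReport n),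
        (A.space : ℝ) ≤ K * (Real.log n ^ 3 / (ν ^ 3 * η ^ 2)) ∧
        ∀ u : List (Fin n), u ≠ [] → u.length ≤ n ^ c →
          ENNReal.ofReal (1 - 1 / (n : ℝ) ^ d) ≤
            A.prob u (fun R => R.IsCorrect ν η (windowFreq W u)) := by
  set C : ℕ := 8 * (2 * c + d + 4) + (c + 3) + (6 + 2 * (2 * c + d + 4)) * (c + 3) * (c + 2) with hC
  -- `C` counts bits in units of `l ^ 3 * w`; 27 comes from `l ≤ 3 log n`, and `101 * 400²` from `w
  -- ≤ 101 / δ²` with `δ > νη / 400`.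
  refine ⟨C * 27 * (101 * 160000), by positivity, fun n W hn hW ν η hν hη => ?_⟩
  obtain ⟨hν0, hν1⟩ := hν
  obtain ⟨hη0, hη1⟩ := hη
  rcases Nat.lt_or_ge n 2 with hn2 | hn2
  -- Here `log n = 0` allows no memory at all, but the required probability `1 - 1 / 1 ^ d` is 0
  -- too.
  · obtain rfl : n = 1 := by omega
    exact ⟨⟨0, 0, id, fun M _ _ => M, fun _ => ⟨∅, 0⟩⟩, by simp [StreamingAlgorithm.space],
      fun u _ _ => by simp⟩
  -- `δ` is rational because estimates are; its upper bound gives the accuracy, its lower bound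
  -- limits `w`.
  obtain ⟨δ, hδ1, hδ2⟩ := exists_rat_btwn (show ν * η / 400 < ν * η / 200 by
    have := mul_pos hν0 hη0; linarith)
  have hνη : 0 < ν * η := mul_pos hν0 hη0
  have hδ0 : (0 : ℝ) < δ := by linarith [div_pos hνη (by norm_num : (0 : ℝ) < 400)]
  have hδ1' : (δ : ℝ) < 1 / 800 := by nlinarith
  set w := ⌈100 / (δ : ℝ) ^ 2⌉₊ with hw
  set l := Nat.clog 2 n with hl
  have hlpos : 0 < l := Nat.clog_pos one_lt_two hn2
  have hnl : n ≤ 2 ^ l := Nat.le_pow_clog one_lt_two n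
  have hwδ : 100 ≤ (w : ℝ) * δ ^ 2 := by
    rw [← div_le_iff₀ (by positivity)]
    exact Nat.le_ceil _
  have hδsq : (δ : ℝ) ^ 2 < 1 / 640000 := by
    calc (δ : ℝ) ^ 2 < (1 / 800) ^ 2 := by gcongr
      _ = _ := by norm_num
  have hw512 : 512 ≤ w := by
    have : (512 : ℝ) ≤ w := by
      by_contra! hcon
      have : (w : ℝ) * δ ^ 2 ≤ 512 * (1 / 640000) := by gcongr
      linarith
    exact_mod_cast this
  have hwle : (w : ℝ) ≤ 101 * 160000 / (ν * η) ^ 2 := by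
    have h1 : (w : ℝ) < 100 / (δ : ℝ) ^ 2 + 1 := Nat.ceil_lt_add_one (by positivity)
    have h2 : (1 : ℝ) ≤ 1 / (δ : ℝ) ^ 2 := by
      rw [le_div_iff₀ (by positivity)]; linarith
    have h3 : 1 / (δ : ℝ) ^ 2 ≤ 1 / (ν * η / 400) ^ 2 := by gcongr
    calc (w : ℝ) ≤ 101 * (1 / (δ : ℝ) ^ 2) := by
          have : 100 / (δ : ℝ) ^ 2 = 100 * (1 / (δ : ℝ) ^ 2) := by ring
          linarith
      _ ≤ 101 * (1 / (ν * η / 400) ^ 2) := by gcongr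
      _ = _ := by field_simp; norm_num
  have hnpow : ∀ e, n ^ e ≤ 2 ^ (e * l) := fun e => by
    rw [mul_comm, pow_mul]; exact Nat.pow_le_pow_left hnl e
  have htwo : ∀ e, 2 ^ e ≤ 2 ^ (e * l) := fun e =>
    Nat.pow_le_pow_right two_pos (Nat.le_mul_of_pos_right e hlpos)
  have hone : ∀ e, 1 ≤ n ^ e := fun e => Nat.one_le_pow _ _ hn
  have hB1 : 2 * n ^ c + 1 ≤ 2 ^ ((c + 3) * l) := by
    calc 2 * n ^ c + 1 ≤ 2 ^ 3 * n ^ c := by have := hone c; omega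
      _ ≤ 2 ^ (3 * l) * 2 ^ (c * l) := Nat.mul_le_mul (htwo 3) (hnpow c)
      _ = _ := by rw [← pow_add]; ring_nf
  have hB2 : n * (n ^ c + 1) + 1 ≤ 2 ^ ((c + 3) * l) := by
    calc n * (n ^ c + 1) + 1 ≤ 2 ^ 2 * (n * n ^ c) := by
          have h1 := hone c
          have h2 : n ≤ n * n ^ c := Nat.le_mul_of_pos_right n h1
          rw [mul_add]
          omega
      _ = 2 ^ 2 * n ^ (c + 1) := by rw [pow_succ' n c]
      _ ≤ 2 ^ (2 * l) * 2 ^ ((c + 1) * l) := Nat.mul_le_mul (htwo 2) (hnpow (c + 1))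
      _ = _ := by rw [← pow_add]; ring_nf
  -- The extra scale beyond `c * l` pays for the factor `4/5`.
  have hK : ((n ^ c : ℕ) : ℝ) ^ 2 < 4 / 5 * 4 ^ (c * l + 1) := by
    have h1 : ((n ^ c : ℕ) : ℝ) ≤ 2 ^ (c * l) := by exact_mod_cast hnpow c
    calc ((n ^ c : ℕ) : ℝ) ^ 2 ≤ (2 ^ (c * l)) ^ 2 := by gcongr
      _ = 4 ^ (c * l) := by rw [← pow_mul, mul_comm (c * l) 2, pow_mul]; norm_num
      _ < 4 / 5 * 4 ^ (c * l + 1) := by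
        rw [pow_succ]
        have : (0 : ℝ) < 4 ^ (c * l) := by positivity
        linarith
  have hk : (n ^ c + 1) ^ 2 * (n + 1) * n ^ d ≤ 4 ^ ((2 * c + d + 4) * l) := by
    have h1 : n ^ c + 1 ≤ 2 ^ ((c + 1) * l) := by
      calc n ^ c + 1 ≤ 2 ^ 1 * n ^ c := by have := hone c; omega
        _ ≤ 2 ^ (1 * l) * 2 ^ (c * l) := Nat.mul_le_mul (htwo 1) (hnpow c)
        _ = _ := by rw [← pow_add]; ring_nf
    have h2 : n + 1 ≤ 2 ^ (2 * l) := by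
      calc n + 1 ≤ n * n := by nlinarith
        _ = n ^ 2 := by ring
        _ ≤ _ := hnpow 2
    calc (n ^ c + 1) ^ 2 * (n + 1) * n ^ d
        ≤ (2 ^ ((c + 1) * l)) ^ 2 * 2 ^ (2 * l) * 2 ^ (d * l) :=
          Nat.mul_le_mul (Nat.mul_le_mul (Nat.pow_le_pow_left h1 2) h2) (hnpow d)
      _ = 2 ^ ((2 * c + d + 4) * l) := by
        rw [← pow_mul, ← pow_add, ← pow_add]; ring_nf
      _ ≤ _ := Nat.pow_le_pow_left (by norm_num) _
  obtain ⟨A, hA, hprob⟩ := exists_heavyHitters_algorithm hlpos.ne' hnl hB1 hB2 hK hW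
    (by exact_mod_cast hδ0) hw512 hwδ ⟨hν0, hν1⟩ hη0 hδ2.le (hone d) hk
  refine ⟨A, ?_, fun u hu hlen => by simpa using hprob u hu hlen⟩
  -- The dominant term is at most `(c + 2) * l` scales times `2 * p * l` rows times `w` counters of
  -- `(c + 3) * l` bits.
  have hspace : A.space ≤ C * (l ^ 3 * w) := by
    have hl1 : 1 ≤ l := hlpos
    have hw1 : 1 ≤ w := by omega
    set p := 2 * c + d + 4
    have hl23 : l ^ 2 ≤ l ^ 3 := Nat.pow_le_pow_right hl1 (by norm_num)
    have hl13 : l ≤ l ^ 3 := Nat.le_self_pow (by norm_num) l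
    have t1 : 2 * (2 * l * w * (2 * (p * l))) ≤ 8 * p * (l ^ 3 * w) := by
      calc _ = 8 * p * (l ^ 2 * w) := by ring
        _ ≤ _ := by gcongr
    have t2 : (c + 3) * l ≤ (c + 3) * (l ^ 3 * w) := by
      calc (c + 3) * l = (c + 3) * (l * 1) := by ring
        _ ≤ _ := by gcongr
    have t3 : 2 * ((c + 3) * l) + ((c + 3) * l * w * (2 * (p * l)) +
        ((c + 3) * l * w + (c + 3) * l * w)) ≤ (6 + 2 * p) * (c + 3) * (l ^ 2 * w) := by
      have e1 : (c + 3) * l ≤ (c + 3) * (l ^ 2 * w) := by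
        calc (c + 3) * l = (c + 3) * (l ^ 1 * 1) := by ring
          _ ≤ (c + 3) * (l ^ 2 * w) := by gcongr; norm_num
      have e2 : (c + 3) * l * w ≤ (c + 3) * (l ^ 2 * w) := by
        calc (c + 3) * l * w = (c + 3) * (l ^ 1 * w) := by ring
          _ ≤ (c + 3) * (l ^ 2 * w) := by gcongr; norm_num
      have e3 : (c + 3) * l * w * (2 * (p * l)) = 2 * p * ((c + 3) * (l ^ 2 * w)) := by ring
      have e4 : (6 + 2 * p) * (c + 3) * (l ^ 2 * w) = 6 * ((c + 3) * (l ^ 2 * w)) +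
        2 * p * ((c + 3) * (l ^ 2 * w)) := by ring
      omega
    have t4 : c * l + 1 + 1 ≤ (c + 2) * l := by
      have : (c + 2) * l = c * l + 2 * l := by ring
      omega
    rw [hA]
    calc _ ≤ 8 * p * (l ^ 3 * w) + ((c + 3) * (l ^ 3 * w) +
          (6 + 2 * p) * (c + 3) * (l ^ 2 * w) * ((c + 2) * l)) :=
        Nat.add_le_add t1 (Nat.add_le_add t2 (Nat.mul_le_mul t3 t4))
      _ = _ := by rw [hC]; ring
  have hlog : (l : ℝ) ≤ 3 * Real.log n := clog_two_le_three_mul_log hn2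
  have hlog0 : 0 ≤ Real.log n := Real.log_natCast_nonneg n
  -- The construction needs only `1 / ν²`; the cube is a weakening, as `ν < 1`.
  have hν3 : 1 / (ν * η) ^ 2 ≤ 1 / (ν ^ 3 * η ^ 2) := by
    apply one_div_le_one_div_of_le (by positivity)
    rw [mul_pow]
    gcongr ?_ * _
    exact pow_le_pow_of_le_one hν0.le (by linarith) (by norm_num)
  calc (A.space : ℝ) ≤ C * ((l : ℝ) ^ 3 * w) := by exact_mod_cast hspace
    _ ≤ C * ((3 * Real.log n) ^ 3 * (101 * 160000 / (ν * η) ^ 2)) := by gcongr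
    _ = C * 27 * (101 * 160000) * Real.log n ^ 3 * (1 / (ν * η) ^ 2) := by ring
    _ ≤ C * 27 * (101 * 160000) * Real.log n ^ 3 * (1 / (ν ^ 3 * η ^ 2)) := by gcongr
    _ = _ := by ring
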